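/- Let $\mathbb F$ be a field of characteristic $p>3$, let $n\ge 3$ and let $\underline t=(t_1,\dots,t_n)$ be a tuple of positive integers. Let $\mathcal O(n,n)=\mathcal O(n)\otimes\Lambda(n)$ be the tensor product of the divided power algebra with basis $x^{(\alpha)}$ ($\alpha\in\mathbb N_0^n$; write $x_i=x^{(\varepsilon_i)}$, $1\le i\le n$) and the exterior algebra on odd generators $x_{n+1},\dots,x_{2n}$, with basis the $x^{(\alpha)}x^u$ ($u=\{i_1<\dots<i_k\}\subseteq\{n+1,\dots,2n\}$, $x^u=x_{i_1}\cdots x_{i_k}$, $|u|=k$), and let $\partial_1,\dots,\partial_{2n}$ be the superderivations of $\mathcal O(n,n)$ given by $\partial_r(x^{(\alpha)}x^u)=x^{(\alpha-\varepsilon_r)}x^u$ for $r\le n$ (zero if $\alpha_r=0$) and $\partial_r(x^{(\alpha)}x^u)=x^{(\alpha)}\,\partial x^u/\partial x_r$ for $r>n$. Let $\mathcal O(n,n;\underline t)$ be the span of the $x^{(\alpha)}x^u$ with $\alpha_i<p^{t_i}$ for all $i$, graded by $\deg x^{(\alpha)}x^u=|\alpha|+|u|$, and let $W(n,n;\underline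 t)=\{\sum_{r=1}^{2n} f_r\partial_r : f_r\in\mathcal O(n,n;\underline t)\}$, a Lie superalgebra with $\mathbb Z$-gradation $W(n,n;\underline t)_k=\{\sum_r f_r\partial_r : f_r\in\mathcal O(n,n;\underline t)_{k+1}\}$. Put $i'=i+n$ and $\mu(i)=0$ for $i\le n$, and $i'=i-n$ and $\mu(i)=1$ for $i>n$. Let $\mathrm{T_H}$ be the linear map with $\mathrm{T_H}(a)=\sum_{i=1}^{2n}(-1)^{\mu(i)\mathrm p(a)}\partial_i(a)\partial_{i'}$ for $\mathbb Z_2$-homogeneous $a$ of parity $\mathrm p(a)$, and let $HO(n,n;\underline t)=\mathrm{T_H}(\mathcal O(n,n;\underline t))$. Let $\mathcal W$ and $\mathcal{HO}$ be the even parts of $W(n,n;\underline t)$ and $HO(n,n;\underline t)$; they are $\mathbb Z$-graded Lie algebras with $\mathcal W_k=\mathcal W\cap W(n,n;\underline t)_k$ and $\mathcal{HO}_k=\mathcal{HO}\cap\mathcal W_k$. Let $\mathrm{Der}_k(\mathcal{HO})$ be the space of derivations $\phi$ of $\mathcal{HO}$ with $\phi(\mathcal{HO}_i)\subseteq\mathcal{HO}_{k+i}$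 for all $i\in\mathbb Z$, and put $\Gamma=\sum_{i=1}^n x_{i'}\partial_{i'}\in\mathcal W$. For a subspace $V\subseteq\mathcal W$ write $V_k=V\cap\mathcal W_k$, and $\mathrm{ad}\,V$ for the set of maps $x\mapsto[E,x]$ on $\mathcal{HO}$ with $E\in V$. Then: 1. $\mathrm{Der}_k(\mathcal{HO})=\mathrm{ad}\,\mathcal{HO}_k$ for every integer $k>0$; 2. $\mathrm{Der}_0(\mathcal{HO})=\mathrm{ad}\,(\mathcal{HO}+\mathbb F\Gamma)_0$; 3. for every integer $k\ge 0$, the elements of $\mathcal W_k$ that normalize $\mathcal{HO}$ are exactly those of $(\mathcal{HO}+\mathbb F\Gamma)_k$. -/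

import Mathlib

namespace OddHamiltonian

/-- The index set `Y = Y₀ ∪ Y₁` of the `2n` variables. The element `Sum.inl i` is the index `i` in
`Y₀ = {1, …, n}`, and `Sum.inr i` is the index `i' = i + n` in `Y₁ = {n + 1, …, 2n}`; the involution
`r ↦ r'` is `Sum.swap`. -/
abbrev Y (n : ℕ) : Type := Fin n ⊕ Fin n

/-- The parity `μ` of the indices. -/
def mu {n : ℕ} : Y n → ℕ
  | Sum.inl _ => 0
  | Sum.inr _ => 1

@[simp] theorem mu_inl {n : ℕ} (i : Fin n) : mu (Sum.inl i : Y n) = 0 := rfl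

@[simp] theorem mu_inr {n : ℕ} (i : Fin n) : mu (Sum.inr i : Y n) = 1 := rfl

/-- The underlying space of `𝒪(n, n) = 𝒪(n) ⊗ Λ(n)`: the free `F`-module on the symbols
`x^(α) x^u` with `α ∈ ℕ₀ⁿ` and `u` a set of odd variables (written in increasing order). -/
abbrev OO (F : Type*) [Field F] (n : ℕ) : Type _ := ((Fin n → ℕ) × Finset (Fin n)) →₀ F

variable (F : Type*) [Field F] (n : ℕ)

/-- The basis element `x^(α) x^u`. -/
noncomputable def mon (α : Fin n → ℕ) (u : Finset (Fin n)) : OO F n := Finsupp.single (α, u) 1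

/-- The number of pairs `(i, j) ∈ u × v` with `j < i`: the number of transpositions needed to
bring the product `x^u x^v` to increasing order. -/
def inv {n : ℕ} (u v : Finset (Fin n)) : ℕ := ((u ×ˢ v).filter (fun q => q.2 < q.1)).card

/-- The sign in `x^u x^v = ± x^(u ∪ v)` (zero if `u` and `v` meet). -/
def eps {n : ℕ} (u v : Finset (Fin n)) : F := if Disjoint u v then (-1) ^ inv u v else 0

/-- The multi-binomial coefficient `binom (α + β) α`. -/
def binom {n : ℕ} (α β : Fin n → ℕ) : ℕ := ∏ i, (α i + β i).choose (α i)

/-- The multiplication of `𝒪(n, n)`: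
`x^(α) x^u · x^(β) x^v = binom (α + β) α · x^(α + β) · (x^u x^v)`. -/
noncomputable def mul : OO F n →ₗ[F] OO F n →ₗ[F] OO F n :=
  Finsupp.linearCombination F fun a => Finsupp.linearCombination F fun b =>
    ((binom a.1 b.1 : F) * eps F a.2 b.2) • mon F n (a.1 + b.1) (a.2 ∪ b.2)

/-- The superderivations `∂_r`, `r ∈ Y`, of `𝒪(n, n)`; for odd `r` the sign comes from moving the
variable `x_r` to the front of `x^u`. -/
noncomputable def pd : Y n → (OO F n →ₗ[F] OO F n)
  | Sum.inl i => Finsupp.linearCombination F fun a =>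
      if a.1 i = 0 then 0 else mon F n (a.1 - Pi.single i 1) a.2
  | Sum.inr i => Finsupp.linearCombination F fun a =>
      if i ∈ a.2 then ((-1) ^ (a.2.filter (fun j => j < i)).card : F) • mon F n a.1 (a.2.erase i)
      else 0

/-- The parity involution: `a ↦ (-1)^(p(a)) a` on homogeneous elements. -/
noncomputable def sig : OO F n →ₗ[F] OO F n :=
  Finsupp.linearCombination F fun a => ((-1) ^ a.2.card : F) • mon F n a.1 a.2

/-- The variable `x_r`, `r ∈ Y`. -/
noncomputable def X : Y n → OO F n
  | Sum.inl i => mon F n (Pi.single i 1) ∅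
  | Sum.inr i => mon F n 0 {i}

/-- The `ℤ₂`-homogeneous component of `𝒪(n, n)` of parity `θ`. -/
noncomputable def par (θ : ℕ) : Submodule F (OO F n) :=
  Finsupp.supported F F {a | a.2.card ≡ θ [MOD 2]}

variable {n}

/-- The truncated algebra `𝒪(n, n; t) = span {x^(α) x^u | α_i ≤ p^(t_i) - 1}`. -/
noncomputable def OT (p : ℕ) (t : Fin n → ℕ) : Submodule F (OO F n) :=
  Finsupp.supported F F {a | ∀ i, a.1 i < p ^ t i}

/-- The component `𝒪(n, n; t)_k = span {x^(α) x^u | |α| + |u| = k}` of the `ℤ`-gradation. -/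
noncomputable def OTdeg (p : ℕ) (t : Fin n → ℕ) (k : ℤ) : Submodule F (OO F n) :=
  Finsupp.supported F F {a | (∀ i, a.1 i < p ^ t i) ∧ ((∑ i, a.1 i + a.2.card : ℕ) : ℤ) = k}

/-- The operator `∑_{r ∈ Y} f_r ∂_r` on `𝒪(n, n)` with coefficients `f`. -/
noncomputable def vf : (Y n → OO F n) →ₗ[F] Module.End F (OO F n) :=
  ∑ r, (LinearMap.lcomp F (OO F n) (pd F n r)) ∘ₗ mul F n ∘ₗ LinearMap.proj r

/-- `T_H(a) = ∑_{r ∈ Y} (-1)^(μ(r) p(a)) ∂_r(a) ∂_{r'}`. -/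
noncomputable def TH : OO F n →ₗ[F] Module.End F (OO F n) :=
  ∑ r, (LinearMap.lcomp F (OO F n) (pd F n r.swap)) ∘ₗ mul F n ∘ₗ pd F n r ∘ₗ sig F n ^ mu r

/-- The subspace of parity `θ` of `W(n, n; t) = {∑ f_r ∂_r | f_r ∈ 𝒪(n, n; t)}`. -/
noncomputable def Wpar (p : ℕ) (t : Fin n → ℕ) (θ : ℕ) : Submodule F (Module.End F (OO F n)) :=
  (Submodule.pi Set.univ fun r => OT F p t ⊓ par F n (θ + mu r)).map (vf F)

theorem vf_apply (f : Y n → OO F n) (h : OO F n) : vf F f h = ∑ r, mul F n (f r) (pd F n r h) := by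
  simp [vf]

theorem TH_apply (a h : OO F n) :
    TH F a h = ∑ r : Y n, mul F n (pd F n r ((sig F n ^ mu r) a)) (pd F n r.swap h) := by
  simp [TH]


theorem mul_mon (α β : Fin n → ℕ) (u v : Finset (Fin n)) :
    mul F n (mon F n α u) (mon F n β v) =
      ((binom α β : F) * eps F u v) • mon F n (α + β) (u ∪ v) := by
  simp [mul, mon]

theorem pd_inl_mon (i : Fin n) (α : Fin n → ℕ) (u : Finset (Fin n)) :
    pd F n (Sum.inl i) (mon F n α u) = if α i = 0 then 0 else mon F n (α - Pi.single i 1) u := by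
  simp [pd, mon]

theorem pd_inr_mon (i : Fin n) (α : Fin n → ℕ) (u : Finset (Fin n)) :
    pd F n (Sum.inr i) (mon F n α u) =
      if i ∈ u then ((-1) ^ inv {i} u : F) • mon F n α (u.erase i) else 0 := by
  have : inv {i} u = (u.filter (fun j => j < i)).card := by
    unfold inv
    apply Finset.card_bij (fun q _ => q.2)
    · rintro ⟨a, b⟩ h; grind
    · rintro ⟨a, b⟩ h ⟨c, d⟩ h' e; simp_all
    · intro b hb; exact ⟨(i, b), by simpa using hb, rfl⟩
  rw [this]
  simp [pd, mon]

theorem sig_mon (α : Fin n → ℕ) (u : Finset (Fin n)) :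
    sig F n (mon F n α u) = ((-1) ^ u.card : F) • mon F n α u := by
  simp [sig, mon]

/-- Linear maps out of `𝒪(n, n)` agree if they agree on the standard basis. -/
theorem hom_ext {M : Type*} [AddCommGroup M] [Module F M] {f g : OO F n →ₗ[F] M}
    (h : ∀ α u, f (mon F n α u) = g (mon F n α u)) : f = g := by
  apply Finsupp.lhom_ext
  rintro ⟨α, u⟩ c
  have : (Finsupp.single (α, u) c : OO F n) = c • mon F n α u := by simp [mon]
  rw [this, map_smul, map_smul, h]

theorem inv_eq (u v : Finset (Fin n)) : inv u v = ∑ i ∈ u, ∑ j ∈ v, if j < i then 1 else 0 := by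
  rw [inv, Finset.card_filter, Finset.sum_product]

theorem inv_union_left {u v : Finset (Fin n)} (h : Disjoint u v) (w : Finset (Fin n)) :
    inv (u ∪ v) w = inv u w + inv v w := by
  simp only [inv_eq, Finset.sum_union h]

theorem inv_union_right {v w : Finset (Fin n)} (h : Disjoint v w) (u : Finset (Fin n)) :
    inv u (v ∪ w) = inv u v + inv u w := by
  simp only [inv_eq, Finset.sum_union h, Finset.sum_add_distrib]

theorem inv_add_swap {u v : Finset (Fin n)} (h : Disjoint u v) :
    inv u v + inv v u = u.card * v.card := by
  rw [inv_eq, inv_eq, Finset.sum_comm (s := v), ← Finset.sum_add_distrib]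
  have : ∀ i ∈ u, (∑ j ∈ v, if j < i then 1 else 0) + (∑ j ∈ v, if i < j then 1 else 0) =
      v.card := by
    intro i hi
    rw [← Finset.sum_add_distrib, Finset.card_eq_sum_ones]
    apply Finset.sum_congr rfl
    intro j hj
    have : i ≠ j := fun e => Finset.disjoint_left.1 h hi (e ▸ hj)
    split_ifs <;> grind
  rw [Finset.sum_congr rfl this]; simp

theorem eps_swap (u v : Finset (Fin n)) : eps F u v = (-1) ^ (u.card * v.card) * eps F v u := by
  unfold eps
  by_cases h : Disjoint u v
  · rw [if_pos h, if_pos h.symm, ← inv_add_swap h, pow_add, mul_assoc, ← pow_add, ← two_mul,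
      pow_mul (-1 : F) 2]
    simp
  · rw [if_neg h, if_neg (fun h' => h h'.symm)]; simp

theorem eps_assoc (u v w : Finset (Fin n)) :
    eps F u v * eps F (u ∪ v) w = eps F v w * eps F u (v ∪ w) := by
  unfold eps
  by_cases h1 : Disjoint u v <;> by_cases h2 : Disjoint v w <;> by_cases h3 : Disjoint u w <;>
    simp only [h1, h2, h3, Finset.disjoint_union_left, Finset.disjoint_union_right, if_true,
      if_false, and_self, and_false, mul_zero, zero_mul, and_true]
  rw [inv_union_left h1, inv_union_right h2]
  ring

theorem binom_comm (α β : Fin n → ℕ) : binom α β = binom β α := by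
  unfold binom
  refine Finset.prod_congr rfl fun i _ => ?_
  rw [Nat.choose_symm_add, add_comm]

theorem binom_assoc (α β γ : Fin n → ℕ) :
    binom α β * binom (α + β) γ = binom β γ * binom α (β + γ) := by
  unfold binom
  rw [← Finset.prod_mul_distrib, ← Finset.prod_mul_distrib]
  refine Finset.prod_congr rfl fun i _ => ?_
  simp only [Pi.add_apply]
  have h := Nat.choose_mul (n := α i + β i + γ i) (k := α i + β i) (s := α i) (by omega)
  rw [show α i + β i + γ i - α i = β i + γ i by omega,
    show α i + β i - α i = β i by omega] at h
  rw [mul_comm, h, mul_comm, add_assoc]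

theorem mul_assoc' (a b c : OO F n) : mul F n (mul F n a b) c = mul F n a (mul F n b c) := by
  have h1 : (mul F n).flip c ∘ₗ (mul F n).flip b = (mul F n).flip (mul F n b c) := by
    refine hom_ext F fun α u => ?_
    have h2 : (mul F n).flip c ∘ₗ mul F n (mon F n α u)
        = mul F n (mon F n α u) ∘ₗ (mul F n).flip c := by
      refine hom_ext F fun β v => ?_
      have h3 : mul F n (mul F n (mon F n α u) (mon F n β v))
          = mul F n (mon F n α u) ∘ₗ mul F n (mon F n β v) := by
        refine hom_ext F fun γ w => ?_
        simp only [LinearMap.comp_apply, mul_mon, map_smul, LinearMap.smul_apply, smul_smul,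
          add_assoc, Finset.union_assoc]
        congr 1
        have e1 := eps_assoc F u v w
        have e2 := congrArg (Nat.cast (R := F)) (binom_assoc α β γ)
        push_cast at e2
        linear_combination (eps F u v * eps F (u ∪ v) w) * e2 +
          ((binom β γ : F) * binom α (β + γ)) * e1
      exact congrArg (fun f => f c) h3
    exact congrArg (fun f => f b) h2
  exact congrArg (fun f => f a) h1

theorem eps_sq {u v : Finset (Fin n)} (h : Disjoint u v) : eps F u v * eps F u v = 1 := by
  rw [eps, if_pos h, ← pow_add, ← two_mul, pow_mul]; simp

theorem neg_one_pow_sq (k : ℕ) : ((-1) ^ k : F) * (-1) ^ k = 1 := by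
  rw [← pow_add, ← two_mul, pow_mul]; simp

theorem sign_eq {i : Fin n} {u : Finset (Fin n)} (h : i ∈ u) :
    ((-1) ^ inv {i} u : F) = eps F {i} (u.erase i) := by
  rw [eps, if_pos (by simp)]
  congr 1
  simp [inv_eq, ← Finset.add_sum_erase u _ h]

theorem pd_inr_mon' (i : Fin n) (α : Fin n → ℕ) (u : Finset (Fin n)) :
    pd F n (Sum.inr i) (mon F n α u) =
      if i ∈ u then eps F {i} (u.erase i) • mon F n α (u.erase i) else 0 := by
  rw [pd_inr_mon]
  split_ifs with h
  · rw [sign_eq F h]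
  · rfl

theorem sig_pow_mon (k : ℕ) (α : Fin n → ℕ) (u : Finset (Fin n)) :
    (sig F n ^ k) (mon F n α u) = ((-1) ^ (k * u.card) : F) • mon F n α u := by
  induction k with
  | zero => simp
  | succ k ih =>
    rw [pow_succ', Module.End.mul_apply, ih, map_smul, sig_mon, smul_smul, ← pow_add]
    congr 2; ring

theorem binom_pascal (i : Fin n) (α β : Fin n → ℕ) :
    (if α i + β i = 0 then 0 else binom α β) =
      (if α i = 0 then 0 else binom (α - Pi.single i 1) β) +
      (if β i = 0 then 0 else binom α (β - Pi.single i 1)) := by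
  have e : ∀ α β : Fin n → ℕ, binom α β = (α i + β i).choose (α i) *
      ∏ j ∈ Finset.univ.erase i, (α j + β j).choose (α j) := fun α β =>
    (Finset.mul_prod_erase _ _ (Finset.mem_univ i)).symm
  have e1 : ∏ j ∈ Finset.univ.erase i, ((α - Pi.single i 1 : Fin n → ℕ) j + β j).choose ((α - Pi.single i 1 : Fin n → ℕ) j)
      = ∏ j ∈ Finset.univ.erase i, (α j + β j).choose (α j) := by
    refine Finset.prod_congr rfl fun j hj => ?_
    have : j ≠ i := Finset.ne_of_mem_erase hj
    simp [Pi.single_eq_of_ne this]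
  have e2 : ∏ j ∈ Finset.univ.erase i, (α j + (β - Pi.single i 1 : Fin n → ℕ) j).choose (α j)
      = ∏ j ∈ Finset.univ.erase i, (α j + β j).choose (α j) := by
    refine Finset.prod_congr rfl fun j hj => ?_
    have : j ≠ i := Finset.ne_of_mem_erase hj
    simp [Pi.single_eq_of_ne this]
  rw [e, e, e, e1, e2]
  simp only [Pi.sub_apply, Pi.single_eq_same]
  generalize ∏ j ∈ Finset.univ.erase i, (α j + β j).choose (α j) = P
  rcases α i with _ | a <;> rcases hb : β i with _ | b <;> simp
  rw [show a + 1 + (b + 1) = (a + b + 1) + 1 by ring, Nat.choose_succ_succ,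
    show a + (b + 1) = a + b + 1 by ring, show a + 1 + b = a + b + 1 by ring]
  ring

theorem pd_mul_mon (r : Y n) (α β : Fin n → ℕ) (u v : Finset (Fin n)) :
    pd F n r (mul F n (mon F n α u) (mon F n β v)) =
      mul F n (pd F n r (mon F n α u)) (mon F n β v) +
      mul F n ((sig F n ^ mu r) (mon F n α u)) (pd F n r (mon F n β v)) := by
  rw [sig_pow_mon, mul_mon, map_smul]
  rcases r with i | i
  · simp only [pd_inl_mon, mu, Pi.add_apply]
    have e := congrArg (Nat.cast (R := F)) (binom_pascal i α β)
    have s1 : α i ≠ 0 → α - Pi.single i 1 + β = α + β - Pi.single i 1 := by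
      intro h; ext j; by_cases hj : j = i
      · subst hj; simp; omega
      · simp [Pi.single_eq_of_ne hj]
    have s2 : β i ≠ 0 → α + (β - Pi.single i 1) = α + β - Pi.single i 1 := by
      intro h; ext j; by_cases hj : j = i
      · subst hj; simp; omega
      · simp [Pi.single_eq_of_ne hj]
    by_cases h1 : α i = 0 <;> by_cases h2 : β i = 0
    · simp [h1, h2]
    · simp only [h1, h2, s2, zero_add, if_true, if_false, zero_mul, pow_zero, one_smul, map_zero,
        LinearMap.zero_apply, mul_mon, ne_eq, not_false_eq_true] at e ⊢
      rw [e]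
    · simp only [h1, h2, s1, add_zero, if_true, if_false, zero_mul, pow_zero, one_smul, map_zero,
        mul_mon, ne_eq, not_false_eq_true] at e ⊢
      rw [e]
    · simp only [h1, h2, s1, s2, Nat.add_eq_zero_iff, false_and, if_false, zero_mul, pow_zero,
        one_smul, mul_mon, ne_eq, not_false_eq_true, ← add_smul] at e ⊢
      rw [e]; push_cast; rw [add_mul]
  · simp only [pd_inr_mon', mu, one_mul, Finset.mem_union]
    by_cases h1 : i ∈ u <;> by_cases h2 : i ∈ v
    · have e0 : eps F u v = 0 := if_neg fun h => Finset.disjoint_left.1 h h1 h2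
      simp only [h1, h2, or_self, if_true, e0, mul_zero, zero_mul, zero_smul, map_smul, LinearMap.smul_apply,
        mul_mon, smul_smul]
      have s : u.erase i ∪ v = u ∪ v.erase i := by grind
      rw [s, ← add_smul, eq_comm]
      convert! zero_smul F _
      have a1 := eps_assoc F (u.erase i) {i} (v.erase i)
      have k1 : u.erase i ∪ {i} = u := by grind
      have k2 : {i} ∪ v.erase i = v := by grind
      rw [k1, k2, eps_swap F (u.erase i) {i}] at a1
      have q1 := eps_sq F (u := {i}) (v := u.erase i) (by simp)
      have q2 := eps_sq F (u := {i}) (v := v.erase i) (by simp)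
      have q3 := neg_one_pow_sq F (u.erase i).card
      have hc : u.card = (u.erase i).card + 1 := (Finset.card_erase_add_one h1).symm
      rw [hc, pow_succ]
      simp only [Finset.card_singleton, mul_one] at a1
      generalize eps F {i} (u.erase i) = A at *
      generalize eps F {i} (v.erase i) = B at *
      generalize eps F (u.erase i) v = C at *
      generalize eps F u (v.erase i) = D at *
      generalize ((-1) ^ (u.erase i).card : F) = E at *
      have : A * C = E * B * D := by
        linear_combination (-A * B) * a1 - A * C * q2 + E * B * D * q1
      linear_combination (binom α β : F) * this
    · have k1 : (u ∪ v).erase i = u.erase i ∪ v := by grind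
      simp only [h1, h2, or_false, if_true, if_false, k1, map_smul, LinearMap.smul_apply,
        mul_mon, smul_smul, map_zero, add_zero]
      congr 1
      have a1 := eps_assoc F {i} (u.erase i) v
      have k2 : {i} ∪ u.erase i = u := by grind
      rw [k2] at a1
      have q1 := eps_sq F (u := {i}) (v := u.erase i) (by simp)
      have q2 := eps_sq F (u := {i}) (v := u.erase i ∪ v) (by simp [h2])
      generalize eps F {i} (u.erase i) = A at *
      generalize eps F {i} (u.erase i ∪ v) = B at *
      linear_combination (binom α β : F) * (A * B * a1 - B * eps F u v * q1
        + A * eps F (u.erase i) v * q2)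
    · have k1 : (u ∪ v).erase i = u ∪ v.erase i := by grind
      simp only [h1, h2, or_true, if_true, if_false, k1, map_smul, LinearMap.smul_apply,
        mul_mon, smul_smul, map_zero, LinearMap.zero_apply, zero_add]
      congr 1
      have a1 := eps_assoc F u {i} (v.erase i)
      have a2 := eps_assoc F {i} u (v.erase i)
      have k2 : {i} ∪ v.erase i = v := by grind
      rw [k2, eps_swap F u {i}, Finset.union_comm u {i}] at a1
      simp only [Finset.card_singleton, mul_one] at a1
      have q1 := eps_sq F (u := {i}) (v := v.erase i) (by simp)
      have q2 := eps_sq F (u := {i}) (v := u ∪ v.erase i) (by simp [h1])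
      generalize eps F {i} (v.erase i) = A at *
      generalize eps F {i} (u ∪ v.erase i) = B at *
      generalize ((-1) ^ u.card : F) = E at *
      linear_combination (binom α β : F) * (-A * B * a1 + A * B * E * a2 - B * eps F u v * q1
        + A * E * eps F u (v.erase i) * q2)
    · simp [h1, h2]

theorem pd_mul (r : Y n) (a b : OO F n) :
    pd F n r (mul F n a b) =
      mul F n (pd F n r a) b + mul F n ((sig F n ^ mu r) a) (pd F n r b) := by
  have h1 : pd F n r ∘ₗ (mul F n).flip b = (mul F n).flip b ∘ₗ pd F n r +
      (mul F n).flip (pd F n r b) ∘ₗ (sig F n ^ mu r) := by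
    refine hom_ext F fun α u => ?_
    have h2 : pd F n r ∘ₗ mul F n (mon F n α u) = mul F n (pd F n r (mon F n α u)) +
        mul F n ((sig F n ^ mu r) (mon F n α u)) ∘ₗ pd F n r := by
      refine hom_ext F fun β v => ?_
      exact pd_mul_mon F r α β u v
    exact congrArg (fun f => f b) h2
  exact congrArg (fun f => f a) h1

theorem pd_comm (r s : Y n) (a : OO F n) :
    pd F n r (pd F n s a) = ((-1) ^ (mu r * mu s) : F) • pd F n s (pd F n r a) := by
  have h1 : pd F n r ∘ₗ pd F n s = ((-1) ^ (mu r * mu s) : F) • (pd F n s ∘ₗ pd F n r) := by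
    refine hom_ext F fun α u => ?_
    simp only [LinearMap.comp_apply, LinearMap.smul_apply]
    rcases r with i | i <;> rcases s with j | j
    · simp only [pd_inl_mon, mu, mul_zero, pow_zero, one_smul]
      by_cases hij : i = j
      · subst hij; rfl
      · have k : α - Pi.single j 1 - Pi.single i 1 = α - Pi.single i 1 - Pi.single j 1 := by
          ext k; simp; omega
        by_cases h1 : α i = 0 <;> by_cases h2 : α j = 0 <;>
          simp [h1, h2, pd_inl_mon, Pi.single_eq_of_ne hij, Pi.single_eq_of_ne (Ne.symm hij), k]
    · by_cases h1 : α i = 0 <;> by_cases h2 : j ∈ u <;>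
        simp [h1, h2, pd_inl_mon, pd_inr_mon', mu]
    · by_cases h1 : α j = 0 <;> by_cases h2 : i ∈ u <;>
        simp [h1, h2, pd_inl_mon, pd_inr_mon', mu]
    · by_cases hij : i = j
      · subst hij; by_cases h1 : i ∈ u <;> simp [pd_inr_mon', h1]
      · by_cases h1 : i ∈ u <;> by_cases h2 : j ∈ u <;>
          simp only [pd_inr_mon', h1, h2, if_true, if_false, map_zero, smul_zero, map_smul,
            Finset.mem_erase, ne_eq, hij, Ne.symm hij, not_false_eq_true,
            and_false, and_true, mu, mul_one, pow_one, smul_smul]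
        rw [Finset.erase_right_comm]
        have k1 : {j} ∪ (u.erase i).erase j = u.erase i := by grind
        have k2 : {i} ∪ (u.erase i).erase j = u.erase j := by grind
        congr 1
        have a1 := eps_assoc F {i} {j} ((u.erase i).erase j)
        have a2 := eps_assoc F {j} {i} ((u.erase i).erase j)
        rw [k1, eps_swap F {i} {j}] at a1
        rw [k2, Finset.union_comm {j} {i}] at a2
        simp only [Finset.card_singleton, mul_one, pow_one] at a1
        linear_combination -a1 - a2
  exact congrArg (fun f => f a) h1


/-- A linear map sends the span of some standard basis elements into a given subspace if it does
so for these basis elements. -/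
theorem map_supported {M : Type*} [AddCommGroup M] [Module F M]
    {s : Set ((Fin n → ℕ) × Finset (Fin n))} {N : Submodule F M} (f : OO F n →ₗ[F] M)
    (h : ∀ α u, (α, u) ∈ s → f (mon F n α u) ∈ N) {a : OO F n}
    (ha : a ∈ Finsupp.supported F F s) : f a ∈ N := by
  rw [Finsupp.supported_eq_span_single] at ha
  have : Submodule.span F ((fun i => Finsupp.single i (1 : F)) '' s) ≤ N.comap f := by
    rw [Submodule.span_le]
    rintro _ ⟨⟨α, u⟩, hx, rfl⟩
    exact h α u hx
  exact this ha

theorem mon_mem {s : Set ((Fin n → ℕ) × Finset (Fin n))} {α : Fin n → ℕ} {u : Finset (Fin n)}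
    (h : (α, u) ∈ s) : mon F n α u ∈ Finsupp.supported F F s :=
  Finsupp.single_mem_supported F 1 h

theorem par_congr {θ φ : ℕ} (h : θ ≡ φ [MOD 2]) : par F n θ = par F n φ := by
  unfold par
  congr 1
  ext a
  exact ⟨fun k => k.trans h, fun k => k.trans h.symm⟩

theorem mul_par {θ φ : ℕ} {a b : OO F n} (ha : a ∈ par F n θ) (hb : b ∈ par F n φ) :
    mul F n a b ∈ par F n (θ + φ) := by
  refine map_supported F (N := par F n (θ + φ)) ((mul F n).flip b) (fun α u hu => ?_) ha
  refine map_supported F (N := par F n (θ + φ)) (mul F n (mon F n α u)) (fun β v hv => ?_) hb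
  rw [mul_mon]
  by_cases h : Disjoint u v
  · refine Submodule.smul_mem _ _ (mon_mem F ?_)
    simp only [Set.mem_ofPred_eq, Finset.card_union_of_disjoint h] at hu hv ⊢
    exact Nat.ModEq.add hu hv
  · simp [eps, h]

theorem pd_par (r : Y n) {θ : ℕ} {a : OO F n} (ha : a ∈ par F n θ) :
    pd F n r a ∈ par F n (θ + mu r) := by
  refine map_supported F (N := par F n (θ + mu r)) (pd F n r) (fun α u hu => ?_) ha
  rcases r with i | i
  · rw [pd_inl_mon]
    split_ifs
    · simp
    · exact mon_mem F hu
  · rw [pd_inr_mon]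
    split_ifs with h
    · refine Submodule.smul_mem _ _ (mon_mem F ?_)
      have := Finset.card_erase_add_one h
      simp only [Set.mem_ofPred_eq, mu, Nat.ModEq] at hu ⊢
      omega
    · simp

theorem sig_pow_par {θ : ℕ} (k : ℕ) {a : OO F n} (ha : a ∈ par F n θ) :
    (sig F n ^ k) a = ((-1) ^ (k * θ) : F) • a := by
  have := map_supported F (N := ⊥) (sig F n ^ k - ((-1) ^ (k * θ) : F) • LinearMap.id)
    (fun α u hu => ?_) ha
  · simpa [sub_eq_zero] using this
  · have e : ((-1) ^ (k * u.card) : F) = (-1) ^ (k * θ) := by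
      rw [mul_comm, mul_comm k, pow_mul, pow_mul]
      congr 1
      exact neg_one_pow_congr (by
        have : u.card % 2 = θ % 2 := hu
        rw [Nat.even_iff, Nat.even_iff, this])
    simp [sig_pow_mon, e]

theorem par_disjoint {a : OO F n} (h0 : a ∈ par F n 0) (h1 : a ∈ par F n 1) : a = 0 := by
  rw [par, Finsupp.mem_supported] at h0 h1
  rw [← Finsupp.support_eq_empty, Finset.eq_empty_iff_forall_notMem]
  intro x hx
  have e0 : x.2.card % 2 = 0 % 2 := h0 hx
  have e1 : x.2.card % 2 = 1 % 2 := h1 hx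
  omega

/-- Supercommutativity: `f g = (-1)^(p(f) p(g)) g f`. -/
theorem mul_comm_par {θ : ℕ} {a : OO F n} (ha : a ∈ par F n θ) (b : OO F n) :
    mul F n a ((sig F n ^ θ) b) = mul F n b a := by
  have := map_supported F (N := ⊥)
    ((mul F n).flip ((sig F n ^ θ) b) - mul F n b) (fun α u hu => ?_) ha
  · simpa [sub_eq_zero] using this
  have h : mul F n (mon F n α u) ∘ₗ (sig F n ^ θ) = (mul F n).flip (mon F n α u) := by
    refine hom_ext F fun β v => ?_
    have e : ((-1) ^ (u.card * v.card) : F) = (-1) ^ (θ * v.card) := by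
      rw [pow_mul, pow_mul]
      congr 1
      exact neg_one_pow_congr (by
        have : u.card % 2 = θ % 2 := hu
        rw [Nat.even_iff, Nat.even_iff, this])
    simp only [LinearMap.comp_apply, LinearMap.flip_apply, sig_pow_mon, map_smul, mul_mon,
      smul_smul, Finset.union_comm v u, add_comm β α, binom_comm β α]
    rw [eps_swap F v u, mul_comm v.card, e]
    congr 1
    ring
  have h' := congrArg (fun f => f b) h
  simp only [LinearMap.comp_apply, LinearMap.flip_apply] at h'
  simp [h']

theorem mul_comm_par' {θ φ : ℕ} {a b : OO F n} (ha : a ∈ par F n θ) (hb : b ∈ par F n φ) :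
    mul F n b a = ((-1) ^ (θ * φ) : F) • mul F n a b := by
  rw [← mul_comm_par F ha, sig_pow_par F θ hb, map_smul]

section truncated

variable (p : ℕ) (t : Fin n → ℕ)

theorem pd_OT (r : Y n) {a : OO F n} (ha : a ∈ OT F p t) : pd F n r a ∈ OT F p t := by
  refine map_supported F (N := OT F p t) (pd F n r) (fun α u hu => ?_) ha
  rcases r with i | i
  · rw [pd_inl_mon]
    split_ifs
    · simp
    · refine mon_mem F fun j => ?_
      exact lt_of_le_of_lt (by simp) (hu j)
  · rw [pd_inr_mon]
    split_ifs
    · exact Submodule.smul_mem _ _ (mon_mem F hu)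
    · simp

theorem sig_OT (k : ℕ) {a : OO F n} (ha : a ∈ OT F p t) : (sig F n ^ k) a ∈ OT F p t := by
  refine map_supported F (N := OT F p t) (sig F n ^ k) (fun α u hu => ?_) ha
  rw [sig_pow_mon]
  exact Submodule.smul_mem _ _ (mon_mem F hu)

theorem dvd_choose {p k a b : ℕ} (hp : p.Prime) (ha : a < p ^ k) (hb : b < p ^ k)
    (hab : p ^ k ≤ a + b) : p ∣ (a + b).choose a := by
  have h := hp.emultiplicity_choose' (n := b) (k := a)
    (b := max (Nat.log p (b + a) + 1) (k + 1)) (by omega)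
  rw [add_comm b a] at h
  rw [← emultiplicity_ne_zero, h]
  have hk : k ≠ 0 := by rintro rfl; simp at ha hb hab; omega
  have : ((Finset.Ico 1 (max (Nat.log p (a + b) + 1) (k + 1))).filter
      (fun i => p ^ i ≤ a % p ^ i + b % p ^ i)).card ≠ 0 := by
    rw [Finset.card_ne_zero]
    refine ⟨k, ?_⟩
    rw [Finset.mem_filter, Finset.mem_Ico, Nat.mod_eq_of_lt ha, Nat.mod_eq_of_lt hb]
    exact ⟨⟨by omega, by omega⟩, hab⟩
  exact_mod_cast this

variable [Fact p.Prime] [CharP F p]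

theorem mul_OT {a b : OO F n} (ha : a ∈ OT F p t) (hb : b ∈ OT F p t) :
    mul F n a b ∈ OT F p t := by
  refine map_supported F (N := OT F p t) ((mul F n).flip b) (fun α u hu => ?_) ha
  refine map_supported F (N := OT F p t) (mul F n (mon F n α u)) (fun β v hv => ?_) hb
  rw [mul_mon]
  by_cases h : ∀ i, α i + β i < p ^ t i
  · exact Submodule.smul_mem _ _ (mon_mem F h)
  · push Not at h
    obtain ⟨i, hi⟩ := h
    have h1 : p ∣ binom α β :=
      (dvd_choose Fact.out (hu i) (hv i) hi).trans (Finset.dvd_prod_of_mem _ (Finset.mem_univ i))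
    rw [(CharP.cast_eq_zero_iff F p _).2 h1]
    simp

end truncated

theorem mul_X_left (a : OO F n) : mul F n a (mon F n 0 ∅) = a := by
  have h : (mul F n).flip (mon F n 0 ∅) = LinearMap.id := by
    refine hom_ext F fun α u => ?_
    simp [mul_mon, binom, eps, inv]
  exact congrArg (fun f => f a) h

theorem pd_X (r s : Y n) : pd F n r (X F n s) = if r = s then mon F n 0 ∅ else 0 := by
  rcases r with i | i <;> rcases s with j | j
  · by_cases h : i = j
    · subst h; simp [X, pd_inl_mon]
    · simp [X, pd_inl_mon, h]
  · simp [X, pd_inl_mon]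
  · simp [X, pd_inr_mon]
  · by_cases h : i = j
    · subst h; simp [X, pd_inr_mon']; simp [eps, inv]
    · simp [X, pd_inr_mon, h]

/-- The coefficients of `∑ f_r ∂_r` are its values on the variables. -/
theorem vf_X (f : Y n → OO F n) (s : Y n) : vf F f (X F n s) = f s := by
  rw [vf_apply, Finset.sum_eq_single s]
  · rw [pd_X, if_pos rfl, mul_X_left]
  · intro r _ h; rw [pd_X, if_neg h, map_zero]
  · simp

theorem vf_injective : Function.Injective (vf F (n := n)) := fun f g h => by
  funext s; rw [← vf_X F f s, h, vf_X]

/-- An even `∑ f_r ∂_r` is a derivation. -/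
theorem vf_mul {f : Y n → OO F n} (hf : ∀ r, f r ∈ par F n (mu r)) (a b : OO F n) :
    vf F f (mul F n a b) = mul F n (vf F f a) b + mul F n a (vf F f b) := by
  simp only [vf_apply, map_sum, LinearMap.sum_apply, ← Finset.sum_add_distrib]
  refine Finset.sum_congr rfl fun r _ => ?_
  rw [pd_mul, map_add, ← mul_assoc', ← mul_assoc', ← mul_assoc', mul_comm_par F (hf r)]

/-- The commutator of two even elements `D = ∑ f_r ∂_r` and `E = ∑ g_r ∂_r` is
`∑ (D(g_s) - E(f_s)) ∂_s`. -/
theorem lie_vf {f g : Y n → OO F n} (hf : ∀ r, f r ∈ par F n (mu r))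
    (hg : ∀ r, g r ∈ par F n (mu r)) :
    vf F f * vf F g - vf F g * vf F f = vf F (fun s => vf F f (g s) - vf F g (f s)) := by
  have hsw : ∀ h : OO F n, ∑ s, mul F n (g s) (vf F f (pd F n s h)) =
      ∑ r, mul F n (f r) (vf F g (pd F n r h)) := by
    intro h
    simp only [vf_apply, map_sum]
    rw [Finset.sum_comm]
    refine Finset.sum_congr rfl fun r _ => Finset.sum_congr rfl fun s _ => ?_
    rw [← mul_assoc', ← mul_assoc', mul_comm_par' F (hf r) (hg s), pd_comm F r s h]
    simp only [map_smul, LinearMap.smul_apply, smul_smul]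
    rw [neg_one_pow_sq, one_smul]
  refine LinearMap.ext fun h => ?_
  rw [LinearMap.sub_apply, Module.End.mul_apply, Module.End.mul_apply]
  conv_lhs => rw [vf_apply F g h, vf_apply F f h]
  rw [map_sum, map_sum, vf_apply]
  simp only [vf_mul F hf, vf_mul F hg, map_sub, LinearMap.sub_apply, Finset.sum_add_distrib,
    Finset.sum_sub_distrib, hsw]
  abel


theorem vf_par {θ φ : ℕ} {f : Y n → OO F n} (hf : ∀ r, f r ∈ par F n (θ + mu r)) {a : OO F n}
    (ha : a ∈ par F n φ) : vf F f a ∈ par F n (θ + φ) := by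
  rw [vf_apply]
  refine Submodule.sum_mem _ fun r _ => ?_
  have h := mul_par F (hf r) (pd_par F r ha)
  rwa [par_congr F (φ := θ + φ)] at h
  simp only [Nat.ModEq]
  omega

/-- The coefficient of `∂_s` in `T_H(a)`. -/
noncomputable def thc (a : OO F n) (s : Y n) : OO F n := pd F n s.swap ((sig F n ^ mu s.swap) a)

theorem TH_eq_vf (a : OO F n) : TH F a = vf F (thc F a) := by
  refine LinearMap.ext fun h => ?_
  rw [TH_apply, vf_apply, ← (Equiv.sumComm (Fin n) (Fin n)).sum_comp]
  simp [thc]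

theorem thc_par {θ : ℕ} {a : OO F n} (ha : a ∈ par F n θ) (s : Y n) :
    thc F a s ∈ par F n (θ + 1 + mu s) := by
  unfold thc
  rw [sig_pow_par F _ ha, map_smul]
  have h := pd_par F s.swap ha
  rw [par_congr F (φ := θ + 1 + mu s)] at h
  · exact Submodule.smul_mem _ _ h
  · rcases s with i | i <;> simp only [Nat.ModEq, mu_inl, mu_inr, Sum.swap_inl, Sum.swap_inr] <;>
      omega

theorem thc_odd {a : OO F n} (ha : a ∈ par F n 1) (s : Y n) : thc F a s ∈ par F n (mu s) := by
  have h := thc_par F ha s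
  rwa [par_congr F (φ := mu s)] at h
  simp only [Nat.ModEq]
  omega

/-- `T_H(c)(b) = -T_H(b)(c)` for odd `b`. -/
theorem TH_skew {θ : ℕ} {b c : OO F n} (hb : b ∈ par F n 1) (hc : c ∈ par F n θ) :
    TH F c b = - TH F b c := by
  rw [TH_apply, TH_apply, ← (Equiv.sumComm (Fin n) (Fin n)).sum_comp, ← Finset.sum_neg_distrib]
  refine Finset.sum_congr rfl fun r _ => ?_
  have h := mul_comm_par' F (pd_par F r hb) (pd_par F r.swap hc)
  simp only [Equiv.sumComm_apply, Sum.swap_swap, sig_pow_par F _ hb, sig_pow_par F _ hc, map_smul,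
    LinearMap.smul_apply, h, smul_smul, ← neg_smul]
  congr 1
  rcases r with i | i
  · simp only [Sum.swap_inl, mu_inl, mu_inr]
    rw [← pow_add, show 1 * θ + (1 + 0) * (θ + 1) = 2 * θ + 1 by ring, pow_add, pow_mul]
    simp
  · simp only [Sum.swap_inr, mu_inl, mu_inr]
    rw [← pow_add, show 0 * θ + (1 + 1) * (θ + 0) = 2 * θ by ring, pow_mul]
    simp

/-- `∂_s (T_H(a)(b)) = T_H(∂_s a)(b) + T_H(a)(∂_s b)` for odd `a`. -/
theorem pd_TH (s : Y n) {a : OO F n} (ha : a ∈ par F n 1) (b : OO F n) :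
    pd F n s (TH F a b) = TH F (pd F n s a) b + TH F a (pd F n s b) := by
  simp only [TH_apply, map_sum, ← Finset.sum_add_distrib]
  refine Finset.sum_congr rfl fun r _ => ?_
  have hsa := pd_par F s ha
  have hra := pd_par F r ha
  rw [pd_mul]
  simp only [sig_pow_par F _ ha, sig_pow_par F _ hsa, map_smul, LinearMap.smul_apply,
    sig_pow_par F _ hra]
  rw [pd_comm F s r a, pd_comm F s r.swap b]
  simp only [map_smul, LinearMap.smul_apply, smul_smul]
  congr 2
  · simp only [← pow_add]
    exact neg_one_pow_congr (by
      rcases r with i | i <;> rcases s with j | j <;> simp)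
  · simp only [← pow_add]
    exact neg_one_pow_congr (by
      rcases r with i | i <;> rcases s with j | j <;> simp <;> decide)

/-- `[T_H(a), T_H(b)] = T_H(T_H(a)(b))` for odd `a` and `b`. -/
theorem lie_TH {a b : OO F n} (ha : a ∈ par F n 1) (hb : b ∈ par F n 1) :
    TH F a * TH F b - TH F b * TH F a = TH F (TH F a b) := by
  have hab : TH F a b ∈ par F n 1 := by
    rw [TH_eq_vf]
    have := vf_par F (θ := 0) (fun r => by simpa using thc_odd F ha r) hb
    simpa using this
  have hE : ∀ s, TH F b (pd F n s a) = - TH F (pd F n s a) b := fun s => by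
    rw [TH_skew F hb (pd_par F s ha), neg_neg]
  rw [TH_eq_vf F a, TH_eq_vf F b, lie_vf F (thc_odd F ha) (thc_odd F hb), ← TH_eq_vf F a,
    ← TH_eq_vf F b, TH_eq_vf F (TH F a b)]
  congr 1
  funext s
  simp only [thc, sig_pow_par F _ ha, sig_pow_par F _ hb, sig_pow_par F _ hab, map_smul, ← smul_sub,
    hE, sub_neg_eq_add, pd_TH F _ ha]
  rw [add_comm]

section truncated

variable (p : ℕ) (t : Fin n → ℕ)

/-- An even element of the form `T_H(a)` is `T_H` of an odd element. -/
theorem exists_odd {a : OO F n} (ha : a ∈ OT F p t) (h : TH F a ∈ Wpar F p t 0) :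
    ∃ b ∈ OT F p t ⊓ par F n 1, TH F b = TH F a := by
  classical
  obtain ⟨f, hf, hfa⟩ := h
  rw [TH_eq_vf] at hfa
  have hfa := vf_injective F hfa
  set a0 := a.filter (fun x => x.2.card % 2 = 0) with h0
  set a1 := a.filter (fun x => ¬ x.2.card % 2 = 0) with h1
  have hsum : a0 + a1 = a := Finsupp.filter_add_filter_not a _
  have p0 : a0 ∈ par F n 0 := by
    rw [par, Finsupp.mem_supported]
    intro x hx
    simp only [h0, Finsupp.support_filter, Finset.coe_filter, Set.mem_ofPred_eq] at hx
    exact hx.2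
  have p1 : a1 ∈ par F n 1 := by
    rw [par, Finsupp.mem_supported]
    intro x hx
    simp only [h1, Finsupp.support_filter, Finset.coe_filter, Set.mem_ofPred_eq] at hx
    simp only [Set.mem_ofPred_eq, Nat.ModEq]
    omega
  have q1 : a1 ∈ OT F p t := by
    rw [OT, Finsupp.mem_supported] at ha ⊢
    intro x hx
    simp only [h1, Finsupp.support_filter, Finset.coe_filter, Set.mem_ofPred_eq] at hx
    exact ha (by simpa using hx.1)
  refine ⟨a1, ⟨q1, p1⟩, ?_⟩
  have hz : thc F a0 = 0 := by
    funext s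
    have e1 : thc F a0 s = f s - thc F a1 s := by
      rw [hfa, ← hsum]; simp [thc]
    have e2 : thc F a0 s ∈ par F n (mu s) := by
      rw [e1]
      exact Submodule.sub_mem _ (by simpa using (hf s trivial).2) (thc_odd F p1 s)
    have e3 := thc_par F p0 s
    rcases s with i | i
    · exact par_disjoint F e2 e3
    · rw [par_congr F (φ := 0) (by simp [Nat.ModEq])] at e3
      exact par_disjoint F e3 e2
  rw [← hsum, map_add, TH_eq_vf F a0, hz, map_zero, zero_add]

variable [Fact p.Prime] [CharP F p]

theorem vf_OT {f : Y n → OO F n} (hf : ∀ r, f r ∈ OT F p t) {a : OO F n} (ha : a ∈ OT F p t) :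
    vf F f a ∈ OT F p t := by
  rw [vf_apply]
  exact Submodule.sum_mem _ fun r _ => mul_OT F p t (hf r) (pd_OT F p t r ha)

/-- The commutator bracket on the operators on `𝒪(n, n)`. -/
noncomputable instance : LieRing (Module.End F (OO F n)) := LieRing.ofAssociativeRing

noncomputable instance : LieAlgebra F (Module.End F (OO F n)) := LieAlgebra.ofAssociativeAlgebra

/-- The Lie algebra `𝒲`: the even part of `W(n, n; t)`. On even elements the bracket of the Lie
superalgebra `W(n, n; t)` is the commutator of operators on `𝒪(n, n)`. -/
noncomputable def WW : LieSubalgebra F (Module.End F (OO F n)) :=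
  { Wpar F p t 0 with
    lie_mem' := by
      rintro _ _ ⟨f, hf, rfl⟩ ⟨g, hg, rfl⟩
      have hf' : ∀ r, f r ∈ par F n (mu r) := fun r => by simpa using (hf r trivial).2
      have hg' : ∀ r, g r ∈ par F n (mu r) := fun r => by simpa using (hg r trivial).2
      rw [LieRing.of_associative_ring_bracket, lie_vf F hf' hg']
      refine ⟨_, fun s _ => ⟨?_, ?_⟩, rfl⟩
      · exact Submodule.sub_mem _ (vf_OT F p t (fun r => (hf r trivial).1) (hg s trivial).1)
          (vf_OT F p t (fun r => (hg r trivial).1) (hf s trivial).1)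
      · exact Submodule.sub_mem _ (vf_par F (fun r => (hf r trivial).2) (hg' s))
          (vf_par F (fun r => (hg r trivial).2) (hf' s)) }

/-- The component `𝒲_k = 𝒲 ∩ {∑ f_r ∂_r | f_r ∈ 𝒪(n, n; t)_(k+1)}` of the `ℤ`-gradation. -/
noncomputable def Wdeg (k : ℤ) : Submodule F (WW F p t) :=
  ((Submodule.pi Set.univ fun _ => OTdeg F p t (k + 1)).map (vf F)).comap
    (WW F p t).toSubmodule.subtype

/-- The Lie algebra `ℋ𝒪`: the even part `HO(n, n; t) ∩ 𝒲` of the odd Hamiltonian superalgebra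
`HO(n, n; t) = {T_H(a) | a ∈ 𝒪(n, n; t)}`. -/
noncomputable def HO : LieSubalgebra F (WW F p t) :=
  { ((OT F p t).map (TH F)).comap (WW F p t).toSubmodule.subtype with
    lie_mem' := by
      rintro ⟨x, hx⟩ ⟨y, hy⟩ ⟨a, ha, hax⟩ ⟨b, hb, hby⟩
      simp only [Submodule.subtype_apply] at hax hby
      subst hax hby
      obtain ⟨a', ⟨ha1, ha2⟩, ha'⟩ := exists_odd F p t ha hx
      obtain ⟨b', ⟨hb1, hb2⟩, hb'⟩ := exists_odd F p t hb hy
      refine ⟨TH F a' b', ?_, ?_⟩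
      · rw [TH_eq_vf]
        exact vf_OT F p t (fun r => pd_OT F p t _ (sig_OT F p t _ ha1)) hb1
      · rw [← lie_TH F ha2 hb2, ha', hb']; rfl }

/-- The component `ℋ𝒪_k = ℋ𝒪 ∩ 𝒲_k` of the `ℤ`-gradation. -/
noncomputable def HOdeg (k : ℤ) : Submodule F (HO F p t) :=
  (Wdeg F p t k).comap (HO F p t).toSubmodule.subtype

/-- The space `Der_k(ℋ𝒪)` of the derivations of `ℋ𝒪` that map `ℋ𝒪_i` into `ℋ𝒪_(k+i)` for all
`i ∈ ℤ`. -/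
noncomputable def DerDeg (k : ℤ) : Submodule F (LieDerivation F (HO F p t) (HO F p t)) where
  carrier := {φ | ∀ i : ℤ, ∀ x ∈ HOdeg F p t i, φ x ∈ HOdeg F p t (k + i)}
  zero_mem' := fun _ _ _ => Submodule.zero_mem _
  add_mem' := fun hφ hψ i x hx => Submodule.add_mem _ (hφ i x hx) (hψ i x hx)
  smul_mem' := fun c _ hφ i x hx => Submodule.smul_mem _ c (hφ i x hx)

/-- The operator `Γ = ∑ x_{i'} ∂_{i'}`, an element of `𝒲`. -/
noncomputable def Gam : WW F p t :=
  ⟨vf F (Sum.elim 0 fun i => X F n (Sum.inr i)), _, by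
    rintro (i | i) -
    · exact Submodule.zero_mem _
    · exact ⟨mon_mem F fun j => pow_pos (Fact.out : p.Prime).pos _,
        mon_mem F (by simp [mu, Nat.ModEq])⟩, rfl⟩

/-- The subspace `ℋ𝒪 + F Γ` of `𝒲`. -/
noncomputable def HOGam : Submodule F (WW F p t) :=
  (HO F p t).toSubmodule ⊔ Submodule.span F {Gam F p t}

/-- A derivation of `ℋ𝒪`, viewed as a linear map from `ℋ𝒪` to `𝒲`. -/
noncomputable def derIncl :
    LieDerivation F (HO F p t) (HO F p t) →ₗ[F] (HO F p t →ₗ[F] WW F p t) where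
  toFun φ := (HO F p t).toSubmodule.subtype ∘ₗ φ.toLinearMap
  map_add' _ _ := rfl
  map_smul' _ _ := rfl

/-- The map `E ↦ ad E|_{ℋ𝒪}`, `(ad E)(x) = [E, x]`, for `E ∈ 𝒲`. -/
noncomputable def adHO : WW F p t →ₗ[F] (HO F p t →ₗ[F] WW F p t) where
  toFun E :=
    { toFun := fun x => ⁅E, (x : WW F p t)⁆
      map_add' := fun x y => lie_add E (x : WW F p t) (y : WW F p t)
      map_smul' := fun c x => lie_smul c E (x : WW F p t) }
  map_add' D E := LinearMap.ext fun x => add_lie D E (x : WW F p t)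
  map_smul' c E := LinearMap.ext fun x => smul_lie c E (x : WW F p t)

theorem derIncl_apply (φ : LieDerivation F (HO F p t) (HO F p t)) (x : HO F p t) :
    derIncl F p t φ x = (φ x : WW F p t) := rfl

theorem adHO_apply (E : WW F p t) (x : HO F p t) : adHO F p t E x = ⁅E, (x : WW F p t)⁆ := rfl

end truncated

end OddHamiltonian

namespace OddHamiltonian

/-! ### Coefficient formulas and the operators of low-degree elements -/

section coefficients

variable (F : Type*) [Field F] {n : ℕ}

/-! The map `TH` identifies `HO` with the odd part of the truncated algebra under the bracket (a, b)
↦ T_H(a)(b), and degree k in `HO` corresponds to degree k + 2 in the algebra. A derivation φ of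
degree k thus becomes a linear map D, and it suffices to show that, for k ≥ 0, D is T_H(b) plus a
multiple of Γ - 1, where the multiple vanishes unless k = 0. This is
`IsBracketDerivation.exists_eq`; by `lie_Gam_TH` the operator Γ - 1 on the odd part is exactly ad Γ
on `HO`.

Since T_H(x_{i'}) = -∂_i, the Leibniz rule says that D commutes with ∂_i up to T_H(·)(D x_{i'}). As
the x_{i'} commute with each other, the elements D x_{i'} satisfy ∂_j(D x_{i'}) = ∂_i(D x_{j'}), so
they are the partial derivatives of one element b, provided that integration does not leave the
truncated algebra. The obstruction, a term of D x_{i'} with α_i = p^(t_i) - 1, is excluded by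
testing D on the quadratic elements x_j x_{i'} (`IsBracketDerivation.apply_eq_zero_of_top`).
Subtracting T_H(b) makes D kill all x_{i'} and commute with all ∂_i. Then D maps each torus element
h_i = x_i x_{i'} to an exterior element; commutation of the h_i shows that a further T_H(b) accounts
for these values too.

What remains commutes with the ∂_i and preserves torus weights modulo p. Induction on |α| leaves
only exterior error terms, and comparison of weight and degree, which uses k ≥ 0 and p > 2, removes
them (`eq_of_weight_eq`). So D multiplies x^(α) x^v by a scalar c(v). For k ≠ 0 this scalar is 0 by
degree. For k = 0 the bracket makes c additive under replacing one element of a set by a disjoint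
set, and c vanishes on singletons, so c(v) = κ(|v| - 1) by `eq_mul_card_sub_one`.

For the normalizer, an element E of degree k ≥ 0 that normalizes `HO` induces a derivation of degree
k, hence agrees on `HO` with some element of `HO` + FΓ. The difference centralizes `HO`, and the
centralizer is zero (`eq_zero_of_lie_HO_eq_zero`). -/

theorem mem_supported_iff {s : Set ((Fin n → ℕ) × Finset (Fin n))} {a : OO F n} :
    a ∈ Finsupp.supported F F s ↔ ∀ α u, a (α, u) ≠ 0 → (α, u) ∈ s := by
  rw [Finsupp.mem_supported]
  constructor
  · intro h α u hu
    exact h (by simpa using hu)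
  · rintro h ⟨α, u⟩ hu
    exact h α u (by simpa using hu)

theorem mon_apply (α β : Fin n → ℕ) (u v : Finset (Fin n)) :
    mon F n α u (β, v) = if α = β ∧ u = v then 1 else 0 := by
  simp [mon, Finsupp.single_apply]

/-- In the divided power basis ∂_i is a pure shift of coefficients, without numerical factors; this
is what makes integration possible in characteristic p. -/
theorem pd_inl_apply (i : Fin n) (a : OO F n) (α : Fin n → ℕ) (u : Finset (Fin n)) :
    pd F n (Sum.inl i) a (α, u) = a (α + Pi.single i 1, u) := by
  have h : Finsupp.lapply (α, u) ∘ₗ pd F n (Sum.inl i) =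
      Finsupp.lapply (R := F) (M := F) (α + Pi.single i 1, u) := by
    refine hom_ext F fun β v => ?_
    simp only [LinearMap.comp_apply, Finsupp.lapply_apply, pd_inl_mon, mon_apply]
    by_cases hb : β i = 0
    · have : β ≠ α + Pi.single i 1 := fun e => by
        have := congrFun e i
        simp [hb] at this
      simp [hb, this]
    · have : β - Pi.single i 1 = α ↔ β = α + Pi.single i 1 := by
        constructor
        · rintro rfl
          ext j
          by_cases hj : j = i
          · subst hj; simp; omega
          · simp [Pi.single_eq_of_ne hj]
        · rintro rfl
          ext j
          simp
      simp [hb, this, mon_apply]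
  exact congrArg (fun f => f a) h

theorem binom_zero_left (α : Fin n → ℕ) : binom 0 α = 1 := by simp [binom]

theorem binom_single (i : Fin n) {α : Fin n → ℕ} (h : α i ≠ 0) :
    binom (Pi.single i 1) (α - Pi.single i 1) = α i := by
  unfold binom
  rw [Finset.prod_eq_single i]
  · simp only [Pi.single_eq_same, Pi.sub_apply, Nat.choose_one_right]
    omega
  · intro j _ hj
    simp [Pi.single_eq_of_ne hj]
  · simp

theorem eps_empty_left (u : Finset (Fin n)) : eps F ∅ u = 1 := by simp [eps, inv]

theorem eps_ne_zero {u v : Finset (Fin n)} (h : Disjoint u v) : eps F u v ≠ 0 := fun e => by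
  simpa [e] using eps_sq F h

theorem mul_X_pd_inl (i : Fin n) (α : Fin n → ℕ) (u : Finset (Fin n)) :
    mul F n (mon F n (Pi.single i 1) ∅) (pd F n (Sum.inl i) (mon F n α u)) =
      (α i : F) • mon F n α u := by
  rw [pd_inl_mon]
  split_ifs with h
  · simp [h]
  · have : Pi.single i 1 + (α - Pi.single i 1) = α := by
      ext j
      by_cases hj : j = i
      · subst hj; simp; omega
      · simp [Pi.single_eq_of_ne hj]
    rw [mul_mon, binom_single i h, this, eps_empty_left]
    simp

theorem mul_X_pd_inr (i : Fin n) (α : Fin n → ℕ) (u : Finset (Fin n)) :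
    mul F n (mon F n 0 {i}) (pd F n (Sum.inr i) (mon F n α u)) =
      (if i ∈ u then 1 else 0 : F) • mon F n α u := by
  rw [pd_inr_mon']
  split_ifs with h
  · have : {i} ∪ u.erase i = u := by grind
    rw [map_smul, mul_mon, binom_zero_left, this, smul_smul, zero_add]
    have := eps_sq F (u := {i}) (v := u.erase i) (by simp)
    simp [this]
  · simp

theorem TH_X_inr (i : Fin n) (a : OO F n) :
    TH F (mon F n 0 {i}) a = - pd F n (Sum.inl i) a := by
  rw [TH_apply, Fintype.sum_sum_type, Finset.sum_eq_zero, zero_add, Finset.sum_eq_single i]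
  · have : mul F n (mon F n 0 ∅) = LinearMap.id := by
      refine hom_ext F fun β v => ?_
      simp [mul_mon, binom_zero_left, eps_empty_left]
    simp [sig_mon, pd_inr_mon', eps, inv, this]
  · intro j _ hj
    simp [sig_mon, pd_inr_mon', hj]
  · simp
  · intro j _
    simp [pd_inl_mon]

theorem TH_linear (i j : Fin n) (a : OO F n) :
    TH F (mon F n (Pi.single j 1) {i}) a =
      mul F n (mon F n 0 {i}) (pd F n (Sum.inr j) a) -
        mul F n (mon F n (Pi.single j 1) ∅) (pd F n (Sum.inl i) a) := by
  rw [TH_apply, Fintype.sum_sum_type, Finset.sum_eq_single j, Finset.sum_eq_single i,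
    sub_eq_add_neg]
  · simp [sig_mon, pd_inl_mon, pd_inr_mon', eps, inv]
  · intro k _ hk
    simp [sig_mon, pd_inr_mon', hk]
  · simp
  · intro k _ hk
    simp [pd_inl_mon, Pi.single_eq_of_ne hk]
  · simp

/-- The elements x_i x_{i'} span a torus whose weight vectors are the monomials; these weights drive
all later comparisons of coefficients. -/
theorem TH_torus_mon (i : Fin n) (α : Fin n → ℕ) (u : Finset (Fin n)) :
    TH F (mon F n (Pi.single i 1) {i}) (mon F n α u) =
      ((if i ∈ u then 1 else 0) - (α i : F)) • mon F n α u := by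
  rw [TH_linear, mul_X_pd_inl, mul_X_pd_inr, sub_smul]

theorem TH_torus_apply (i : Fin n) (a : OO F n) (α : Fin n → ℕ) (u : Finset (Fin n)) :
    TH F (mon F n (Pi.single i 1) {i}) a (α, u) =
      ((if i ∈ u then 1 else 0) - (α i : F)) * a (α, u) := by
  have h : Finsupp.lapply (α, u) ∘ₗ TH F (mon F n (Pi.single i 1) {i}) =
      ((if i ∈ u then 1 else 0) - (α i : F)) • Finsupp.lapply (R := F) (M := F) (α, u) := by
    refine hom_ext F fun β v => ?_
    simp only [LinearMap.comp_apply, TH_torus_mon, LinearMap.smul_apply, Finsupp.lapply_apply,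
      Finsupp.smul_apply, mon_apply]
    by_cases h : β = α ∧ v = u
    · obtain ⟨rfl, rfl⟩ := h
      simp
    · simp [h]
  exact congrArg (fun f => f a) h

/-- The operator x_{i'} ∂_{j'} replaces the odd variable j by i, so exactly one source monomial
contributes to the coefficient. -/
theorem mul_X_pd_inr_apply {i j : Fin n} {u : Finset (Fin n)} (hi : i ∈ u)
    (hj : j ∉ u) (a : OO F n) (α : Fin n → ℕ) :
    mul F n (mon F n 0 {i}) (pd F n (Sum.inr j) a) (α, u) =
      (eps F {j} (u.erase i) * eps F {i} (u.erase i)) * a (α, insert j (u.erase i)) := by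
  have h : Finsupp.lapply (α, u) ∘ₗ mul F n (mon F n 0 {i}) ∘ₗ pd F n (Sum.inr j) =
      (eps F {j} (u.erase i) * eps F {i} (u.erase i)) •
        Finsupp.lapply (R := F) (M := F) (α, insert j (u.erase i)) := by
    refine hom_ext F fun β w => ?_
    simp only [LinearMap.comp_apply, LinearMap.smul_apply, Finsupp.lapply_apply, mon_apply,
      pd_inr_mon']
    by_cases hw : w = insert j (u.erase i)
    · have e1 : j ∈ w := by grind
      have e2 : w.erase j = u.erase i := by grind
      have e3 : {i} ∪ u.erase i = u := by grind
      rw [if_pos e1, e2, map_smul, mul_mon, binom_zero_left, e3]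
      simp [hw, mon_apply]
    · by_cases hjw : j ∈ w
      · by_cases hiw : i ∈ w.erase j
        · have : ¬ Disjoint {i} (w.erase j) := by simpa using hiw
          rw [if_pos hjw, map_smul, mul_mon, eps, eps, if_neg this]
          simp [hw]
        · have : ¬ insert i (w.erase j) = u := by grind
          simp [hjw, hw, mul_mon, mon_apply, this]
      · simp [hjw, hw]
  exact congrArg (fun f => f a) h

end coefficients

/-! ### The gradation and derivations of the odd part -/

section degree

variable (F : Type*) [Field F] {n : ℕ} (p : ℕ) (t : Fin n → ℕ)

/-- The odd part of `𝒪(n, n; t)`, which `T_H` identifies with `ℋ𝒪`. -/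
noncomputable def OddPart : Submodule F (OO F n) := OT F p t ⊓ par F n 1

theorem mem_OddPart {a : OO F n} : a ∈ OddPart F p t ↔
    ∀ α u, a (α, u) ≠ 0 → (∀ i, α i < p ^ t i) ∧ u.card % 2 = 1 := by
  rw [OddPart, Submodule.mem_inf, OT, par, mem_supported_iff, mem_supported_iff]
  exact ⟨fun h α u hu => ⟨h.1 α u hu, h.2 α u hu⟩,
    fun h => ⟨fun α u hu => (h α u hu).1, fun α u hu => (h α u hu).2⟩⟩

theorem mon_mem_OddPart {α : Fin n → ℕ} {u : Finset (Fin n)} (hα : ∀ i, α i < p ^ t i)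
    (hu : u.card % 2 = 1) : mon F n α u ∈ OddPart F p t :=
  ⟨mon_mem F hα, mon_mem F hu⟩

theorem mem_OTdeg {m : ℤ} {a : OO F n} : a ∈ OTdeg F p t m ↔
    ∀ α u, a (α, u) ≠ 0 → (∀ i, α i < p ^ t i) ∧ ((∑ i, α i + u.card : ℕ) : ℤ) = m := by
  rw [OTdeg, mem_supported_iff]
  rfl

theorem pd_OTdeg (r : Y n) {m : ℤ} {a : OO F n} (ha : a ∈ OTdeg F p t m) :
    pd F n r a ∈ OTdeg F p t (m - 1) := by
  refine map_supported F (N := OTdeg F p t (m - 1)) (pd F n r) (fun α u hu => ?_) ha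
  obtain ⟨h1, h2⟩ := hu
  rcases r with i | i
  · rw [pd_inl_mon]
    split_ifs with h
    · simp
    · refine mon_mem F ⟨fun j => lt_of_le_of_lt (by simp) (h1 j), ?_⟩
      have e : ∑ j, α j = ∑ j, (α - Pi.single i 1 : Fin n → ℕ) j + 1 := by
        have : α = (α - Pi.single i 1) + Pi.single i 1 := by
          ext j
          by_cases hj : j = i
          · subst hj; simp; omega
          · simp [Pi.single_eq_of_ne hj]
        conv_lhs => rw [this]
        simp [Finset.sum_add_distrib]
      simp only at h2 ⊢
      omega
  · rw [pd_inr_mon]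
    split_ifs with h
    · refine Submodule.smul_mem _ _ (mon_mem F ⟨h1, ?_⟩)
      have := Finset.card_erase_add_one h
      simp only at h2 ⊢
      omega
    · simp

theorem sig_OTdeg (k : ℕ) {m : ℤ} {a : OO F n} (ha : a ∈ OTdeg F p t m) :
    (sig F n ^ k) a ∈ OTdeg F p t m := by
  refine map_supported F (N := OTdeg F p t m) (sig F n ^ k) (fun α u hu => ?_) ha
  rw [sig_pow_mon]
  exact Submodule.smul_mem _ _ (mon_mem F hu)

variable [Fact p.Prime] [CharP F p]

theorem mul_OTdeg {l m : ℤ} {a b : OO F n} (ha : a ∈ OTdeg F p t l) (hb : b ∈ OTdeg F p t m) :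
    mul F n a b ∈ OTdeg F p t (l + m) := by
  refine map_supported F (N := OTdeg F p t (l + m)) ((mul F n).flip b) (fun α u hu => ?_) ha
  refine map_supported F (N := OTdeg F p t (l + m)) (mul F n (mon F n α u)) (fun β v hv => ?_) hb
  obtain ⟨hu1, hu2⟩ := hu
  obtain ⟨hv1, hv2⟩ := hv
  have h := mul_OT F p t (mon_mem F (α := α) (u := u) hu1) (mon_mem F (α := β) (u := v) hv1)
  rw [OT, mem_supported_iff] at h
  rw [mem_OTdeg]
  intro γ w hw
  refine ⟨h γ w hw, ?_⟩
  rw [mul_mon, Finsupp.smul_apply, mon_apply] at hw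
  by_cases hd : Disjoint u v
  · have he : α + β = γ ∧ u ∪ v = w := by
      by_contra he
      simp [he] at hw
    obtain ⟨rfl, rfl⟩ := he
    rw [Finset.card_union_of_disjoint hd]
    simp only [Pi.add_apply, Finset.sum_add_distrib] at hu2 hv2 ⊢
    push_cast at hu2 hv2 ⊢
    omega
  · simp [eps, hd] at hw

/-- Each summand of T_H(a)(b) differentiates a once and b once, whence the shift by 2. -/
theorem TH_OTdeg {l m : ℤ} {a b : OO F n} (ha : a ∈ OTdeg F p t l) (hb : b ∈ OTdeg F p t m) :
    TH F a b ∈ OTdeg F p t (l + m - 2) := by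
  rw [TH_apply]
  refine Submodule.sum_mem _ fun r _ => ?_
  have := mul_OTdeg F p t (pd_OTdeg F p t r (sig_OTdeg F p t (mu r) ha))
    (pd_OTdeg F p t r.swap hb)
  rwa [show l - 1 + (m - 1) = l + m - 2 by ring] at this

theorem TH_OddPart {a b : OO F n} (ha : a ∈ OddPart F p t) (hb : b ∈ OddPart F p t) :
    TH F a b ∈ OddPart F p t := by
  constructor
  · rw [TH_eq_vf]
    exact vf_OT F p t (fun r => pd_OT F p t _ (sig_OT F p t _ ha.1)) hb.1
  · rw [TH_eq_vf]
    have := vf_par F (θ := 0) (fun r => by simpa using thc_odd F ha.2 r) hb.2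
    simpa using this

/-- The derivations of degree `k` of the odd part of `𝒪(n, n; t)` under the bracket
`(a, b) ↦ T_H(a)(b)`. -/
structure IsBracketDerivation (k : ℤ) (D : OO F n →ₗ[F] OO F n) : Prop where
  mem : ∀ {a}, a ∈ OddPart F p t → D a ∈ OddPart F p t
  leibniz : ∀ {a b}, a ∈ OddPart F p t → b ∈ OddPart F p t →
    D (TH F a b) = TH F (D a) b + TH F a (D b)
  deg : ∀ {m a}, a ∈ OddPart F p t → a ∈ OTdeg F p t m → D a ∈ OTdeg F p t (m + k)

variable {F p t}

/-- By `lie_TH` the operator T_H(b) is itself a derivation of the bracket, of degree k when b has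
degree k + 2. This permits successive normalization of D. -/
theorem IsBracketDerivation.sub_TH {k : ℤ} {D : OO F n →ₗ[F] OO F n}
    (hD : IsBracketDerivation F p t k D) {b : OO F n} (hb : b ∈ OddPart F p t)
    (hbk : b ∈ OTdeg F p t (k + 2)) : IsBracketDerivation F p t k (D - TH F b) where
  mem ha := Submodule.sub_mem _ (hD.mem ha) (TH_OddPart F p t hb ha)
  leibniz {x y} hx hy := by
    have := LinearMap.congr_fun (lie_TH F hb.2 hx.2) y
    simp only [LinearMap.sub_apply, Module.End.mul_apply] at this
    simp only [LinearMap.sub_apply, hD.leibniz hx hy, map_sub, ← this]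
    abel
  deg {m a} ha ham := by
    have := TH_OTdeg F p t hbk ham
    rw [show k + 2 + m - 2 = m + k by ring] at this
    exact Submodule.sub_mem _ (hD.deg ha ham) this

end degree

/-! ### Normalizing a derivation on the x_{i'} and the x_i x_{i'} -/

section

variable {F : Type*} [Field F] {n p : ℕ} {t : Fin n → ℕ}

/-- An element of the odd part with prescribed partial derivatives. -/
theorem exists_primitive {m : ℤ} (b : Fin n → OO F n) (hb : ∀ i, b i ∈ OddPart F p t)
    (hm : ∀ i, b i ∈ OTdeg F p t m)
    (hc : ∀ i j, pd F n (Sum.inl j) (b i) = pd F n (Sum.inl i) (b j))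
    (hz : ∀ i α u, α i = p ^ t i - 1 → b i (α, u) = 0) :
    ∃ c ∈ OddPart F p t, c ∈ OTdeg F p t (m + 1) ∧ ∀ i, pd F n (Sum.inl i) c = b i := by
  classical
  -- The coefficient at α is read off from b_i at α - ε_i for any i with α_i ≠ 0; `hc` makes the
  -- choice of i irrelevant. The constant of integration, at α = 0, is taken to be 0.
  set g : (Fin n → ℕ) × Finset (Fin n) → F := fun x =>
    if h : ∃ i, x.1 i ≠ 0 then b h.choose (x.1 - Pi.single h.choose 1, x.2) else 0 with hg
  have key : ∀ α u, g (α, u) ≠ 0 → ∃ i, ∃ β, α = β + Pi.single i 1 ∧ b i (β, u) ≠ 0 := by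
    intro α u h
    simp only [hg] at h
    split_ifs at h with h0
    · refine ⟨h0.choose, α - Pi.single h0.choose 1, ?_, h⟩
      have := h0.choose_spec
      ext j
      by_cases hj : j = h0.choose
      · rw [hj]; simp; omega
      · simp [Pi.single_eq_of_ne hj]
    · exact absurd rfl h
  have hfin : g.support.Finite := by
    refine Set.Finite.subset (Set.finite_iUnion fun i : Fin n =>
      ((b i).support.finite_toSet.image fun x => (x.1 + Pi.single i 1, x.2))) ?_
    rintro ⟨α, u⟩ h
    obtain ⟨i, β, rfl, hβ⟩ := key α u h
    exact Set.mem_iUnion.2 ⟨i, (β, u), by simpa using hβ, rfl⟩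
  have hbd : ∀ α u, g (α, u) ≠ 0 → ((∀ i, α i < p ^ t i) ∧ u.card % 2 = 1) ∧
      ((∑ i, α i + u.card : ℕ) : ℤ) = m + 1 := by
    intro α u h
    obtain ⟨i, β, rfl, hβ⟩ := key α u h
    obtain ⟨h1, h2⟩ := (mem_OddPart F p t).1 (hb i) _ _ hβ
    obtain ⟨-, h3⟩ := (mem_OTdeg F p t).1 (hm i) _ _ hβ
    refine ⟨⟨fun j => ?_, h2⟩, ?_⟩
    · by_cases hj : j = i
      · subst hj
        have := h1 j
        -- Only the absence of top exponents in b_j keeps the raised exponent below p^(t_j).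
        have h4 : β j ≠ p ^ t j - 1 := fun e => hβ (hz j β u e)
        simp; omega
      · simpa [Pi.single_eq_of_ne hj] using h1 j
    · simp only [Pi.add_apply, Finset.sum_add_distrib, Finset.sum_pi_single', Finset.mem_univ,
        if_true]
      push_cast at h3 ⊢
      omega
  refine ⟨Finsupp.ofSupportFinite g hfin, (mem_OddPart F p t).2 fun α u h => (hbd α u h).1,
    (mem_OTdeg F p t).2 fun α u h => ⟨(hbd α u h).1.1, (hbd α u h).2⟩, fun i => ?_⟩
  ext ⟨α, u⟩
  rw [pd_inl_apply]
  change g (α + Pi.single i 1, u) = _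
  have h0 : ∃ j, (α + Pi.single i 1 : Fin n → ℕ) j ≠ 0 := ⟨i, by simp⟩
  simp only [hg]
  rw [dif_pos h0]
  have hspec := h0.choose_spec
  generalize h0.choose = j at hspec
  by_cases hj : j = i
  · subst hj
    simp
  · have e : α + Pi.single i 1 - Pi.single j 1 = α - Pi.single j 1 + Pi.single i 1 := by
      ext l
      by_cases hl : l = j
      · subst hl; simp [Pi.single_eq_of_ne hj]
      · simp [Pi.single_eq_of_ne hl]
    have e' : α - Pi.single j 1 + Pi.single j 1 = α := by
      ext l
      by_cases hl : l = j
      · subst hl; simp [Pi.single_eq_of_ne hj] at hspec ⊢; omega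
      · simp [Pi.single_eq_of_ne hl]
    have := congrArg (fun a => a (α - Pi.single j 1, u)) (hc j i)
    simp only [pd_inl_apply, e'] at this
    rw [e, this]

variable [Fact p.Prime]

theorem odd_variable_mem_OddPart (i : Fin n) : mon F n 0 {i} ∈ OddPart F p t :=
  mon_mem_OddPart F p t (fun _ => pow_pos (Fact.out : p.Prime).pos _) (by simp)

theorem linear_mem_OddPart (ht : ∀ i, 0 < t i) (i j : Fin n) :
    mon F n (Pi.single j 1) {i} ∈ OddPart F p t := by
  refine mon_mem_OddPart F p t (fun l => ?_) (by simp)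
  have : 1 < p ^ t l := Nat.one_lt_pow (ht l).ne' (Fact.out : p.Prime).one_lt
  by_cases h : l = j
  · subst h; simpa
  · simp [Pi.single_eq_of_ne h]; omega

theorem odd_variable_mem_OTdeg (i : Fin n) : mon F n 0 {i} ∈ OTdeg F p t 1 :=
  mon_mem F ⟨fun _ => pow_pos (Fact.out : p.Prime).pos _, by simp⟩

theorem linear_mem_OTdeg (ht : ∀ i, 0 < t i) (i j : Fin n) :
    mon F n (Pi.single j 1) {i} ∈ OTdeg F p t 2 := by
  refine mon_mem F ⟨?_, by simp⟩
  have h := (linear_mem_OddPart (F := F) (p := p) ht i j)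
  rw [mem_OddPart] at h
  exact (h (Pi.single j 1) {i} (by simp [mon_apply])).1

theorem TH_odd_variable_right (i : Fin n) {b : OO F n} (hb : b ∈ OddPart F p t) :
    TH F b (mon F n 0 {i}) = pd F n (Sum.inl i) b := by
  rw [TH_skew F (odd_variable_mem_OddPart (p := p) (t := t) i).2 hb.2, TH_X_inr, neg_neg]

/-- This is the Leibniz rule for the pair (x_{i'}, f), because T_H(x_{i'}) = -∂_i. The last term is
the failure of D to commute with ∂_i. -/
theorem IsBracketDerivation.pd_inl {k : ℤ} {D : OO F n →ₗ[F] OO F n}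
    (hD : IsBracketDerivation F p t k D) (i : Fin n) {f : OO F n} (hf : f ∈ OddPart F p t) :
    pd F n (Sum.inl i) (D f) = D (pd F n (Sum.inl i) f) - TH F f (D (mon F n 0 {i})) := by
  have hx := odd_variable_mem_OddPart (F := F) (p := p) (t := t) i
  have h := hD.leibniz hx hf
  rw [TH_X_inr, TH_X_inr, TH_skew F hf.2 (hD.mem hx).2, map_neg] at h
  rw [← sub_eq_zero] at h ⊢
  exact (by abel : _ = _).trans h

/-- Up to an inner derivation, a derivation that kills the `x_{i'}` also kills the `x_i x_{i'}`. -/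
theorem IsBracketDerivation.exists_sub_kills_torus {k : ℤ} {D : OO F n →ₗ[F] OO F n}
    (hD : IsBracketDerivation F p t k D) (ht : ∀ i, 0 < t i)
    (h0 : ∀ i, D (mon F n 0 {i}) = 0) :
    ∃ b ∈ OddPart F p t, b ∈ OTdeg F p t (k + 2) ∧ (∀ i, (D - TH F b) (mon F n 0 {i}) = 0) ∧
      ∀ i, (D - TH F b) (mon F n (Pi.single i 1) {i}) = 0 := by
  classical
  have hh : ∀ i, mon F n (Pi.single i 1) {i} ∈ OddPart F p t := fun i => linear_mem_OddPart ht i i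
  set g : Fin n → OO F n := fun i => D (mon F n (Pi.single i 1) {i}) with hgdef
  have hg : ∀ i, g i ∈ OddPart F p t := fun i => hD.mem (hh i)
  have hgk : ∀ i, g i ∈ OTdeg F p t (2 + k) := fun i =>
    hD.deg (hh i) (linear_mem_OTdeg ht i i)
  -- Since D kills the x_{i'}, it commutes with every ∂_j on the odd part; ∂_j(x_i x_{i'}) is 0 or
  -- x_{i'}, so all ∂_j kill g_i, which leaves exterior terms only.
  have hgc : ∀ i α u, α ≠ 0 → g i (α, u) = 0 := by
    intro i α u hα
    obtain ⟨j, hj⟩ : ∃ j, α j ≠ 0 := by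
      by_contra! h
      exact hα (funext h)
    have h := congrArg (fun a => a (α - Pi.single j 1, u)) (hD.pd_inl j (hh i))
    have e : α - Pi.single j 1 + Pi.single j 1 = α := by
      ext l
      by_cases hl : l = j
      · subst hl; simp; omega
      · simp [Pi.single_eq_of_ne hl]
    simp only [pd_inl_apply, e, h0, map_zero, sub_zero] at h
    rw [hgdef]
    simp only
    rw [h, pd_inl_mon]
    by_cases hij : i = j
    · subst hij
      simp [h0]
    · simp [Pi.single_eq_of_ne (Ne.symm hij)]
  -- D is applied to the vanishing bracket of two torus elements. The relation says that g_i(0, u)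
  -- vanishes for i outside u and does not depend on i inside u.
  have hsym : ∀ i j u, (if i ∈ u then 1 else 0) * g j (0, u) =
      (if j ∈ u then 1 else 0) * g i (0, u) := by
    intro i j u
    have h := hD.leibniz (hh i) (hh j)
    rw [TH_torus_mon, TH_skew F (hh j).2 (hg i).2, map_smul] at h
    have e : ((if i ∈ ({j} : Finset (Fin n)) then 1 else 0) -
        ((Pi.single j 1 : Fin n → ℕ) i : F)) = 0 := by
      by_cases hij : i = j
      · subst hij; simp
      · simp [hij]
    rw [e, zero_smul] at h
    have := congrArg (fun a => a (0, u)) h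
    simp only [Finsupp.add_apply, Finsupp.neg_apply, Finsupp.zero_apply, TH_torus_apply,
      Pi.zero_apply, Nat.cast_zero, sub_zero] at this
    linear_combination -this
  -- On x^u with i ∈ u the operator T_H(x_i x_{i'}) is the identity, and T_H(b) applied to x_i
  -- x_{i'} is its negative; hence the sign. The empty set does not matter, as it has even
  -- cardinality.
  set c : Finset (Fin n) → F := fun u => if h : u.Nonempty then - g h.choose (0, u) else 0 with hc
  set b : OO F n := ∑ u, c u • mon F n 0 u with hbdef
  have hb0 : ∀ u, b (0, u) = c u := by
    intro u
    simp [hbdef, Finsupp.finsetSum_apply, mon_apply]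
  have hb1 : ∀ α u, α ≠ 0 → b (α, u) = 0 := by
    intro α u hα
    simp [hbdef, Finsupp.finsetSum_apply, mon_apply, hα.symm]
  have hsupp : ∀ α u, b (α, u) ≠ 0 → ∃ i, g i (α, u) ≠ 0 := by
    intro α u h
    by_cases hα : α = 0
    · subst hα
      rw [hb0] at h
      simp only [hc] at h
      split_ifs at h with hu
      · exact ⟨hu.choose, by simpa using h⟩
      · exact absurd rfl h
    · exact absurd (hb1 α u hα) h
  have hbP : b ∈ OddPart F p t := by
    rw [mem_OddPart]
    intro α u h
    obtain ⟨i, hi⟩ := hsupp α u h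
    exact (mem_OddPart F p t).1 (hg i) _ _ hi
  refine ⟨b, hbP, ?_, fun i => ?_, fun i => ?_⟩
  · rw [mem_OTdeg]
    intro α u h
    obtain ⟨i, hi⟩ := hsupp α u h
    rw [add_comm k 2]
    exact (mem_OTdeg F p t).1 (hgk i) _ _ hi
  · rw [LinearMap.sub_apply, TH_odd_variable_right i hbP, h0, zero_sub, neg_eq_zero]
    ext ⟨α, u⟩
    rw [pd_inl_apply, hb1 _ _ (fun e => by simpa using congrFun e i)]
    rfl
  · rw [LinearMap.sub_apply, TH_skew F (hh i).2 hbP.2, sub_neg_eq_add]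
    change g i + _ = 0
    ext ⟨α, u⟩
    rw [Finsupp.add_apply, TH_torus_apply]
    by_cases hα : α = 0
    · subst hα
      rw [hb0]
      simp only [hc, Pi.zero_apply, Nat.cast_zero, sub_zero, Finsupp.coe_zero]
      split_ifs with h1 h2 h2
      · have := hsym i h2.choose u
        rw [if_pos h1, if_pos h2.choose_spec] at this
        linear_combination -this
      · exact absurd ⟨i, h1⟩ h2
      · have := hsym i h2.choose u
        rw [if_neg h1, if_pos h2.choose_spec] at this
        linear_combination -this
      · by_contra h3
        have := ((mem_OddPart F p t).1 (hg i) 0 u (by simpa using h3)).2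
        rw [Finset.not_nonempty_iff_eq_empty.1 h2] at this
        simp at this
    · rw [hgc i α u hα, hb1 α u hα]
      simp

variable [CharP F p]

/-- The image of `x_{i'}` under a derivation has no term with `α_i = p^(t_i) - 1`. -/
theorem IsBracketDerivation.apply_eq_zero_of_top {k : ℤ} {D : OO F n →ₗ[F] OO F n}
    (hD : IsBracketDerivation F p t k D) (ht : ∀ i, 0 < t i) (i : Fin n) {α : Fin n → ℕ}
    (hα : α i = p ^ t i - 1) (w : Finset (Fin n)) : D (mon F n 0 {i}) (α, w) = 0 := by
  have hx := odd_variable_mem_OddPart (F := F) (p := p) (t := t) i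
  have hb := hD.mem hx
  set b := D (mon F n 0 {i}) with hbdef
  have hpos : 0 < p ^ t i := pow_pos (Fact.out : p.Prime).pos _
  -- A term of ∂_i(D f) with top exponent in x_i would come from a term of D f with exponent
  -- p^(t_i), outside the truncated algebra.
  have htop : ∀ f ∈ OddPart F p t, ∀ u, pd F n (Sum.inl i) (D f) (α, u) = 0 := by
    intro f hf u
    rw [pd_inl_apply]
    by_contra h
    have := ((mem_OddPart F p t).1 (hD.mem hf) _ _ h).1 i
    simp at this
    omega
  have hcast : (α i : F) = -1 := by
    have : ((α i + 1 : ℕ) : F) = 0 := by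
      rw [hα, Nat.sub_add_cancel hpos, CharP.cast_eq_zero_iff F p]
      exact dvd_pow_self p (ht i).ne'
    push_cast at this
    linear_combination this
  by_contra hne
  have hw2 := ((mem_OddPart F p t).1 hb _ _ hne).2
  by_cases hiw : i ∈ w
  -- For f = x_i x_{i'} the torus weight at (α, w) is 1 - α_i = 2, so `pd_inl` reads 0 = b - 2b in
  -- this coefficient.
  · have hf := linear_mem_OddPart (F := F) (p := p) ht i i
    have h := congrArg (fun a => a (α, w)) (hD.pd_inl i hf)
    simp only [htop _ hf] at h
    rw [pd_inl_mon] at h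
    simp only [Pi.single_eq_same, one_ne_zero, if_false, tsub_self, Finsupp.sub_apply,
      TH_torus_apply, ← hbdef, hcast, hiw, if_true] at h
    exact hne (by linear_combination h)
  · obtain ⟨j, hj⟩ : w.Nonempty := by
      rw [Finset.nonempty_iff_ne_empty]
      rintro rfl
      simp at hw2
    -- For f = x_j x_{i'} one has ∂_i f = 0, hence T_H(f)(b) has coefficient zero at top exponents.
    -- Reading it at the set w with j replaced by i isolates ± b(α, w).
    have hij : j ≠ i := fun e => hiw (e ▸ hj)
    have hf := linear_mem_OddPart (F := F) (p := p) ht i j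
    have h := congrArg (fun a => a (α, insert i (w.erase j))) (hD.pd_inl i hf)
    simp only [htop _ hf] at h
    rw [pd_inl_mon, if_pos (Pi.single_eq_of_ne hij.symm 1), map_zero, zero_sub, Finsupp.neg_apply,
      ← hbdef, TH_linear, Finsupp.sub_apply, mul_X_pd_inr_apply F (by simp) (by grind)] at h
    -- The other summand x_j ∂_i b contributes nothing: ∂_i lowers the exponent of x_i below the
    -- top, and multiplication by x_j with j ≠ i does not raise it.
    have hz : mul F n (mon F n (Pi.single j 1) ∅) (pd F n (Sum.inl i) b)
        (α, insert i (w.erase j)) = 0 := by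
      have h1 : pd F n (Sum.inl i) b ∈
          Finsupp.supported F F {x : (Fin n → ℕ) × Finset (Fin n) | x.1 i < p ^ t i - 1} := by
        rw [mem_supported_iff]
        intro β v h
        rw [pd_inl_apply] at h
        have := ((mem_OddPart F p t).1 hb _ _ h).1 i
        simp at this
        simp only [Set.mem_ofPred_eq]
        omega
      have h2 := map_supported F (N := Finsupp.supported F F
        {x : (Fin n → ℕ) × Finset (Fin n) | x.1 i < p ^ t i - 1})
        (mul F n (mon F n (Pi.single j 1) ∅)) (fun β v h => ?_) h1
      · rw [mem_supported_iff] at h2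
        by_contra h3
        have : α i < p ^ t i - 1 := h2 _ _ h3
        omega
      · rw [mul_mon]
        refine Submodule.smul_mem _ _ (mon_mem F ?_)
        simpa [Pi.single_eq_of_ne hij.symm] using h
    have e1 : (insert i (w.erase j)).erase i = w.erase j := by grind
    have e2 : insert j (w.erase j) = w := by grind
    rw [hz, e1, e2, sub_zero, eq_comm, neg_eq_zero, mul_eq_zero, mul_eq_zero] at h
    rcases h with (h | h) | h
    · exact eps_ne_zero F (by simp) h
    · exact eps_ne_zero F (by simp [hiw]) h
    · exact hne h

/-- Up to an inner derivation, every derivation kills the `x_{i'}`. -/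
theorem IsBracketDerivation.exists_sub_kills_variables {k : ℤ} {D : OO F n →ₗ[F] OO F n}
    (hD : IsBracketDerivation F p t k D) (ht : ∀ i, 0 < t i) :
    ∃ b ∈ OddPart F p t, b ∈ OTdeg F p t (k + 2) ∧ ∀ i, (D - TH F b) (mon F n 0 {i}) = 0 := by
  obtain ⟨b, hb, hbk, h⟩ := exists_primitive (m := 1 + k) (fun i => D (mon F n 0 {i}))
    (fun i => hD.mem (odd_variable_mem_OddPart i))
    (fun i => hD.deg (odd_variable_mem_OddPart i) (odd_variable_mem_OTdeg i))
    (fun i j => by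
      rw [hD.pd_inl j (odd_variable_mem_OddPart i), TH_X_inr]
      simp [pd_inl_mon])
    (fun i α u hα => hD.apply_eq_zero_of_top ht i hα u)
  refine ⟨b, hb, by rwa [show k + 2 = 1 + k + 1 by ring], fun i => ?_⟩
  rw [LinearMap.sub_apply, TH_odd_variable_right i hb, h, sub_self]

end

/-! ### Diagonal derivations and the operator Γ -/

section

variable {F : Type*} [Field F] {n p : ℕ} {t : Fin n → ℕ}

theorem Gam_mon (α : Fin n → ℕ) (u : Finset (Fin n)) :
    vf F (Sum.elim 0 fun i => X F n (Sum.inr i)) (mon F n α u) = (u.card : F) • mon F n α u := by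
  rw [vf_apply, Fintype.sum_sum_type, Finset.sum_eq_zero, zero_add]
  · have : ∀ i, mul F n (X F n (Sum.inr i)) (pd F n (Sum.inr i) (mon F n α u)) =
        (if i ∈ u then 1 else 0 : F) • mon F n α u := fun i => mul_X_pd_inr F i α u
    simp only [Sum.elim_inr, this, ← Finset.sum_smul]
    simp
  · simp

/-- Only the derivative with respect to x_i acts nontrivially on the first factor, so a single
monomial survives; its coefficient is a product of signs, hence nonzero. -/
theorem TH_mon_exterior {i : Fin n} {v w : Finset (Fin n)} (hi : i ∈ w)
    (hvw : Disjoint v (w.erase i)) :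
    ∃ s : F, s ≠ 0 ∧
      TH F (mon F n (Pi.single i 1) v) (mon F n 0 w) = s • mon F n 0 (v ∪ w.erase i) := by
  refine ⟨eps F {i} (w.erase i) * eps F v (w.erase i),
    mul_ne_zero (eps_ne_zero F (by simp)) (eps_ne_zero F hvw), ?_⟩
  rw [TH_apply, Fintype.sum_sum_type, Finset.sum_eq_single i, Finset.sum_eq_zero, add_zero]
  · simp [pd_inl_mon, pd_inr_mon', hi, mul_mon, binom_zero_left, smul_smul]
  · intro j _
    simp [pd_inl_mon]
  · intro j _ hj
    simp [pd_inl_mon, Pi.single_eq_of_ne hj]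
  · simp

/-- A function on the sets of odd cardinality which turns the products `x^v · x^(w \ {i})` into
sums is proportional to `|v| - 1`. -/
theorem eq_mul_card_sub_one {c : Finset (Fin n) → F} (h2 : (2 : F) ≠ 0) (hn : 3 ≤ n)
    (h1 : ∀ i, c {i} = 0)
    (hadd : ∀ i v w, v.card % 2 = 1 → w.card % 2 = 1 → i ∈ w → Disjoint v (w.erase i) →
      c (v ∪ w.erase i) = c v + c w) :
    ∃ κ : F, ∀ v, v.card % 2 = 1 → c v = κ * (v.card - 1) := by
  -- c depends on the cardinality only: since c vanishes on singletons, exchanging one element of v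
  -- for one outside v does not change it, and such exchanges lead from v to w.
  have hswap : ∀ m, ∀ v w : Finset (Fin n), v.card % 2 = 1 → v.card = w.card →
      (v \ w).card = m → c v = c w := by
    intro m
    induction m with
    | zero =>
      intro v w _ hc h
      rw [Finset.card_eq_zero, Finset.sdiff_eq_empty_iff_subset] at h
      rw [Finset.eq_of_subset_of_card_le h hc.ge]
    | succ m ih =>
      intro v w hv hc h
      have hwv : (w \ v).card = m + 1 := by
        rw [← h]
        exact (Finset.card_sdiff_comm hc).symm
      obtain ⟨i, hi⟩ := Finset.card_pos.1 (show 0 < (v \ w).card by omega)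
      obtain ⟨j, hj⟩ := Finset.card_pos.1 (show 0 < (w \ v).card by omega)
      rw [Finset.mem_sdiff] at hi hj
      have hcard : ({j} ∪ v.erase i).card = v.card := by
        rw [Finset.card_union_of_disjoint (by simp [hj.2]), Finset.card_singleton, add_comm,
          Finset.card_erase_add_one hi.1]
      have e := hadd i {j} v (by simp) hv hi.1 (by simp [hj.2])
      rw [h1, zero_add] at e
      rw [← e]
      refine ih _ _ (by omega) (by omega) ?_
      have : ({j} ∪ v.erase i) \ w = (v \ w).erase i := by
        clear ih hadd h1 e hcard hwv h hc hv
        grind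
      rw [this, Finset.card_erase_of_mem (by simp [hi]), h]
      rfl
  obtain ⟨w0, -, hw0⟩ := Finset.exists_subset_card_eq
    (s := (Finset.univ : Finset (Fin n))) (n := 3) (by simpa using hn)
  -- The factor κ is forced by a set of three elements, where |v| - 1 = 2.
  refine ⟨c w0 / 2, ?_⟩
  have main : ∀ m, ∀ v : Finset (Fin n), v.card = 2 * m + 1 → c v = m * c w0 := by
    intro m
    induction m with
    | zero =>
      intro v hv
      obtain ⟨i, rfl⟩ := Finset.card_eq_one.1 hv
      simp [h1]
    | succ m ih =>
      intro v hv
      obtain ⟨w, hwv, hw⟩ := Finset.exists_subset_card_eq (s := v) (n := 3) (by omega)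
      obtain ⟨d, hd⟩ := Finset.card_pos.1 (show 0 < w.card by omega)
      have hcd : (w.erase d).card = 2 := by rw [Finset.card_erase_of_mem hd, hw]
      have hsub : w.erase d ⊆ v := (Finset.erase_subset _ _).trans hwv
      have hc' : (v \ w.erase d).card = 2 * m + 1 := by
        rw [Finset.card_sdiff_of_subset hsub]
        omega
      -- Removing two elements of v splits off a three-element set and costs c(w0).
      have e := hadd d (v \ w.erase d) w (by omega) (by omega) hd Finset.sdiff_disjoint
      rw [Finset.sdiff_union_of_subset hsub, ih _ hc', hswap _ w w0 (by omega) (by omega) rfl] at e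
      rw [e]
      push_cast
      ring
  intro v hv
  have hm : v.card = 2 * (v.card / 2) + 1 := by omega
  rw [main _ v hm]
  have : (v.card : F) = 2 * (v.card / 2 : ℕ) + 1 := by
    exact_mod_cast congrArg (Nat.cast (R := F)) hm
  rw [this]
  field_simp
  ring

/-- Two monomials of the same weight with respect to the torus spanned by the `x_i x_{i'}`, the
first of which has the larger degree and involves odd variables only, coincide. -/
theorem eq_of_weight_eq [CharP F p] (hp : 2 < p) {k : ℤ} (hk : 0 ≤ k) {α : Fin n → ℕ}
    {u v : Finset (Fin n)} (hdeg : (u.card : ℤ) = ∑ i, (α i : ℤ) + v.card + k)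
    (hw : ∀ i, ((α i : ℤ) : F) = (((if i ∈ v then 1 else 0) - (if i ∈ u then 1 else 0) : ℤ) : F)) :
    α = 0 ∧ u = v ∧ k = 0 := by
  -- The integers α_i + [i ∈ v] - [i ∈ u] are divisible by p. The one candidate for a negative
  -- value, i ∈ u with i ∉ v, forces p ∣ α_i + 1, so α_i ≥ p - 1 ≥ 2 and the value is positive. As
  -- the integers add up to -k ≤ 0, they all vanish.
  have hterm : ∀ i, 0 ≤ (α i : ℤ) + (if i ∈ v then 1 else 0) - (if i ∈ u then 1 else 0) ∧
      ((α i : ℤ) + (if i ∈ v then 1 else 0) - (if i ∈ u then 1 else 0) = 0 →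
        α i = 0 ∧ (i ∈ u ↔ i ∈ v)) := by
    intro i
    have h := hw i
    by_cases hu : i ∈ u <;> by_cases hv : i ∈ v <;>
      simp only [hu, hv, if_true, if_false] at h ⊢
    · simp
    · have : ((α i + 1 : ℕ) : F) = 0 := by
        push_cast at h ⊢
        linear_combination h
      rw [CharP.cast_eq_zero_iff F p] at this
      have := Nat.le_of_dvd (by omega) this
      constructor
      · omega
      · intro h
        omega
    · constructor
      · omega
      · intro h
        omega
    · simp
  have hsum : ∑ i, ((α i : ℤ) + (if i ∈ v then 1 else 0) - (if i ∈ u then 1 else 0)) = -k := by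
    rw [Finset.sum_sub_distrib, Finset.sum_add_distrib]
    simp
    omega
  have hnn := Finset.sum_nonneg fun i (_ : i ∈ Finset.univ) => (hterm i).1
  have hk0 : k = 0 := by omega
  rw [hk0, neg_zero, Finset.sum_eq_zero_iff_of_nonneg fun i _ => (hterm i).1] at hsum
  refine ⟨funext fun i => ((hterm i).2 (hsum i (Finset.mem_univ i))).1, ?_, hk0⟩
  ext i
  exact ((hterm i).2 (hsum i (Finset.mem_univ i))).2

variable [Fact p.Prime]

theorem exterior_mem_OddPart {v : Finset (Fin n)} (hv : v.card % 2 = 1) :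
    mon F n 0 v ∈ OddPart F p t :=
  mon_mem_OddPart F p t (fun _ => pow_pos (Fact.out : p.Prime).pos _) hv

theorem IsBracketDerivation.apply_exterior_eq_zero {k : ℤ} (hk : k ≠ 0)
    {D : OO F n →ₗ[F] OO F n} (hD : IsBracketDerivation F p t k D) {v : Finset (Fin n)}
    (hv : v.card % 2 = 1) : D (mon F n 0 v) (0, v) = 0 := by
  by_contra hne
  have hdeg := ((mem_OTdeg F p t).1 (hD.deg (exterior_mem_OddPart hv) (m := v.card)
    (mon_mem F ⟨fun _ => pow_pos (Fact.out : p.Prime).pos _, by simp⟩)) _ _ hne).2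
  simp at hdeg
  exact hk hdeg

variable [CharP F p]

/-- A derivation of nonnegative degree that kills the `x_{i'}` and the `x_i x_{i'}` is diagonal. -/
theorem IsBracketDerivation.apply_mon {k : ℤ} (hk : 0 ≤ k) (hp : 2 < p)
    {D : OO F n →ₗ[F] OO F n} (hD : IsBracketDerivation F p t k D) (ht : ∀ i, 0 < t i)
    (h0 : ∀ i, D (mon F n 0 {i}) = 0) (h1 : ∀ i, D (mon F n (Pi.single i 1) {i}) = 0)
    (m : ℕ) {α : Fin n → ℕ} {v : Finset (Fin n)} (hm : ∑ i, α i = m) (hα : ∀ i, α i < p ^ t i)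
    (hv : v.card % 2 = 1) :
    D (mon F n α v) = D (mon F n 0 v) (0, v) • mon F n α v := by
  induction m using Nat.strong_induction_on generalizing α with
  | _ m ih =>
  have hmem := mon_mem_OddPart F p t hα hv
  -- D commutes with ∂_i here, so the induction hypothesis for α - ε_i shows that the error term is
  -- killed by every ∂_i and is therefore exterior.
  have hpd : ∀ i, pd F n (Sum.inl i) (D (mon F n α v) - D (mon F n 0 v) (0, v) • mon F n α v) =
      0 := by
    intro i
    rw [map_sub, hD.pd_inl i hmem, h0, map_zero, sub_zero, map_smul, pd_inl_mon]
    split_ifs with hi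
    · simp
    · rw [sub_eq_zero]
      refine ih _ ?_ rfl fun j => lt_of_le_of_lt (by simp) (hα j)
      rw [← hm]
      refine Finset.sum_lt_sum (fun j _ => by simp) ⟨i, Finset.mem_univ i, ?_⟩
      simp
      omega
  rw [← sub_eq_zero]
  ext ⟨β, u⟩
  by_contra hne
  rw [Finsupp.coe_zero, Pi.zero_apply] at hne
  have hβ : β = 0 := by
    by_contra hβ
    obtain ⟨j, hj⟩ : ∃ j, β j ≠ 0 := by
      by_contra! h
      exact hβ (funext h)
    have h := congrArg (fun a => a (β - Pi.single j 1, u)) (hpd j)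
    have e : β - Pi.single j 1 + Pi.single j 1 = β := by
      ext l
      by_cases hl : l = j
      · subst hl; simp; omega
      · simp [Pi.single_eq_of_ne hl]
    simp only [pd_inl_apply, e] at h
    exact hne h
  subst hβ
  rw [Finsupp.sub_apply, Finsupp.smul_apply, mon_apply] at hne
  by_cases h : α = 0 ∧ v = u
  · obtain ⟨rfl, rfl⟩ := h
    simp at hne
  · rw [if_neg h, smul_zero, sub_zero] at hne
    have hdeg := ((mem_OTdeg F p t).1 (hD.deg hmem (m := ((∑ i, α i + v.card : ℕ) : ℤ))
      (mon_mem F ⟨hα, rfl⟩)) _ _ hne).2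
    -- D kills x_i x_{i'} and so preserves weights: the weight of x^u equals that of x^(α) x^v.
    have hw : ∀ i, ((α i : ℤ) : F) =
        (((if i ∈ v then 1 else 0) - (if i ∈ u then 1 else 0) : ℤ) : F) := by
      intro i
      have e := congrArg (fun a => a (0, u)) (hD.leibniz (linear_mem_OddPart ht i i) hmem)
      simp only [h1, map_zero, LinearMap.zero_apply, zero_add, TH_torus_mon, map_smul,
        Finsupp.smul_apply, TH_torus_apply, Pi.zero_apply, Nat.cast_zero, sub_zero,
        smul_eq_mul] at e
      have := mul_right_cancel₀ hne e
      push_cast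
      linear_combination -this
    refine h ?_
    have := eq_of_weight_eq (F := F) hp hk (α := α) (u := u) (v := v)
      (by simpa using hdeg) hw
    exact ⟨this.1, this.2.1.symm⟩

/-- The derivations of nonnegative degree are inner up to a multiple of `ad Γ`. -/
theorem IsBracketDerivation.exists_eq {k : ℤ} (hk : 0 ≤ k) (hp : 2 < p) (hn : 3 ≤ n)
    {D : OO F n →ₗ[F] OO F n} (hD : IsBracketDerivation F p t k D) (ht : ∀ i, 0 < t i) :
    ∃ b ∈ OddPart F p t, b ∈ OTdeg F p t (k + 2) ∧ ∃ κ : F, (k ≠ 0 → κ = 0) ∧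
      ∀ a ∈ OddPart F p t,
        D a = TH F b a + κ • (vf F (Sum.elim 0 fun i => X F n (Sum.inr i)) a - a) := by
  obtain ⟨b1, hb1, hk1, h1⟩ := hD.exists_sub_kills_variables ht
  have hD1 := hD.sub_TH hb1 hk1
  obtain ⟨b2, hb2, hk2, h2, h3⟩ := hD1.exists_sub_kills_torus ht h1
  have hD2 := hD1.sub_TH hb2 hk2
  set E := D - TH F b1 - TH F b2 with hE
  have hdiag : ∀ {α v}, (∀ i, α i < p ^ t i) → v.card % 2 = 1 →
      E (mon F n α v) = E (mon F n 0 v) (0, v) • mon F n α v :=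
    fun hα hv => hD2.apply_mon hk hp ht h2 h3 _ rfl hα hv
  have h20 : (2 : F) ≠ 0 := by
    have : ((2 : ℕ) : F) ≠ 0 := by
      rw [Ne, CharP.cast_eq_zero_iff F p]
      exact fun h => by have := Nat.le_of_dvd (by norm_num) h; omega
    simpa using this
  have hpos : ∀ i : Fin n, (0 : Fin n → ℕ) i < p ^ t i :=
    fun _ => pow_pos (Fact.out : p.Prime).pos _
  -- The additivity of the eigenvalues is the Leibniz rule for x_i x^v and x^w, whose bracket is a
  -- nonzero multiple of one exterior monomial; the factor x_i does not affect the eigenvalue.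
  obtain ⟨κ, hκ⟩ := eq_mul_card_sub_one (c := fun v => E (mon F n 0 v) (0, v)) h20 hn
    (fun i => by simp only [h2]; rfl) (fun i v w hv hw hi hd => by
      obtain ⟨s, hs, e⟩ := TH_mon_exterior (F := F) hi hd
      have hα : ∀ j, (Pi.single i 1 : Fin n → ℕ) j < p ^ t j := fun j =>
        ((mem_OTdeg F p t).1 (linear_mem_OTdeg (F := F) ht i i) (Pi.single i 1) {i}
          (by simp [mon_apply])).1 j
      have hcard : (v ∪ w.erase i).card % 2 = 1 := by
        rw [Finset.card_union_of_disjoint hd, Finset.card_erase_of_mem hi]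
        omega
      have l := hD2.leibniz (mon_mem_OddPart F p t hα hv) (exterior_mem_OddPart hw)
      rw [hdiag hα hv, hdiag hpos hw] at l
      simp only [map_smul, LinearMap.smul_apply, e] at l
      rw [hdiag hpos hcard] at l
      have := congrArg (fun a => a (0, v ∪ w.erase i)) l
      simp only [Finsupp.add_apply, Finsupp.smul_apply, mon_apply, and_self, if_true, smul_eq_mul,
        mul_one] at this
      refine mul_left_cancel₀ hs ?_
      linear_combination this)
  refine ⟨b1 + b2, Submodule.add_mem _ hb1 hb2, Submodule.add_mem _ hk1 hk2,
    if k = 0 then κ else 0, fun h => if_neg h, ?_⟩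
  intro a ha
  have hspan : a ∈ Finsupp.supported F F
      {x : (Fin n → ℕ) × Finset (Fin n) | (∀ i, x.1 i < p ^ t i) ∧ x.2.card % 2 = 1} := by
    rw [mem_supported_iff]
    exact (mem_OddPart F p t).1 ha
  have hz := map_supported F (N := ⊥)
    (E - (if k = 0 then κ else 0) •
      (vf F (Sum.elim 0 fun i => X F n (Sum.inr i)) - LinearMap.id)) (fun α v h => ?_) hspan
  · rw [Submodule.mem_bot, LinearMap.sub_apply, sub_eq_zero] at hz
    simp only [hE, LinearMap.sub_apply, LinearMap.smul_apply, LinearMap.id_apply] at hz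
    rw [← hz, map_add, LinearMap.add_apply]
    abel
  · rw [Submodule.mem_bot]
    change E (mon F n α v) - (if k = 0 then κ else 0) •
      (vf F (Sum.elim 0 fun i => X F n (Sum.inr i)) (mon F n α v) - mon F n α v) = 0
    rw [hdiag (α := α) (v := v) h.1 h.2, Gam_mon, sub_eq_zero]
    have : E (mon F n 0 v) (0, v) = (if k = 0 then κ else 0) * (v.card - 1) := by
      split_ifs with hk0
      · exact hκ v h.2
      · rw [hD2.apply_exterior_eq_zero hk0 h.2, zero_mul]
    rw [this, mul_smul, sub_smul, one_smul]

end

/-! ### Transfer to `HO`, the normalizer and the centralizer -/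

section

variable {F : Type*} [Field F] {n p : ℕ} {t : Fin n → ℕ}

/-- The values T_H(a)(x_{i'}) = ∂_i a recover all terms with α ≠ 0. Exterior terms are nonconstant
by parity and are seen by T_H(a)(x_i x_{i'}). -/
theorem OddPart.eq_zero_of_TH_eq_zero {a : OO F n} (ha : a ∈ OddPart F p t) (h : TH F a = 0) :
    a = 0 := by
  ext ⟨α, u⟩
  by_contra hne
  rw [Finsupp.coe_zero, Pi.zero_apply] at hne
  have hu := ((mem_OddPart F p t).1 ha _ _ hne).2
  have hx : ∀ i, mon F n 0 {i} ∈ par F n 1 := fun i => mon_mem F rfl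
  have hh : ∀ i, mon F n (Pi.single i 1) {i} ∈ par F n 1 := fun i => mon_mem F rfl
  by_cases hα : α = 0
  · obtain ⟨i, hi⟩ : u.Nonempty := by
      rw [Finset.nonempty_iff_ne_empty]
      rintro rfl
      simp at hu
    have := congrArg (fun x => x (α, u)) (TH_skew F (hh i) ha.2)
    simp only [h, Finsupp.neg_apply, TH_torus_apply, hi, if_true] at this
    simp [hα] at this
    exact hne (hα ▸ this)
  · obtain ⟨i, hi⟩ : ∃ i, α i ≠ 0 := by
      by_contra! h
      exact hα (funext h)
    have := congrArg (fun x => x (α - Pi.single i 1, u)) (TH_skew F (hx i) ha.2)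
    rw [TH_X_inr, neg_neg, h] at this
    have e : α - Pi.single i 1 + Pi.single i 1 = α := by
      ext l
      by_cases hl : l = i
      · subst hl; simp; omega
      · simp [Pi.single_eq_of_ne hl]
    simp only [pd_inl_apply, e] at this
    exact hne this.symm

theorem thc_OTdeg {m : ℤ} {a : OO F n} (ha : a ∈ OTdeg F p t m) (s : Y n) :
    thc F a s ∈ OTdeg F p t (m - 1) :=
  pd_OTdeg F p t _ (sig_OTdeg F p t _ ha)

/-- Γ counts odd variables, and T_H(x^(α) x^u) changes this count by |u| - 1: its coefficient at ∂_i
has |u| - 1 odd variables, while at ∂_{i'} the count |u| is diminished by the removed variable. -/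
theorem lie_Gam_TH {a : OO F n} (ha : a ∈ par F n 1) :
    vf F (Sum.elim 0 fun i => X F n (Sum.inr i)) * TH F a -
      TH F a * vf F (Sum.elim 0 fun i => X F n (Sum.inr i)) =
      TH F (vf F (Sum.elim 0 fun i => X F n (Sum.inr i)) a - a) := by
  set G := vf F (Sum.elim 0 fun i => X F n (Sum.inr i)) with hG
  have := map_supported F (N := ⊥)
    ((LinearMap.mulLeft F G - LinearMap.mulRight F G) ∘ₗ TH F - TH F ∘ₗ (G - LinearMap.id))
    (fun α u hu => ?_) ha
  · simpa [sub_eq_zero] using this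
  · have hm : mon F n α u ∈ par F n 1 := mon_mem F hu
    rw [Submodule.mem_bot, LinearMap.sub_apply, sub_eq_zero]
    change G * TH F (mon F n α u) - TH F (mon F n α u) * G = TH F (G (mon F n α u) - mon F n α u)
    have hg : ∀ r : Y n, (Sum.elim 0 fun i => X F n (Sum.inr i) : Y n → OO F n) r ∈
        par F n (mu r) := by
      rintro (i | i)
      · exact Submodule.zero_mem _
      · exact mon_mem F rfl
    rw [TH_eq_vf, hG, lie_vf F hg (thc_odd F hm), TH_eq_vf F (_ - _)]
    congr 1
    funext s
    rw [← TH_eq_vf, Gam_mon]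
    rcases s with i | i
    · simp only [thc, Sum.swap_inl, mu_inr, pow_one, map_sub, map_smul, sig_mon, pd_inr_mon',
        Sum.elim_inl, Pi.zero_apply, map_zero, sub_zero]
      split_ifs with hi
      · rw [map_smul, Gam_mon, Finset.card_erase_of_mem hi, Nat.cast_pred (Finset.card_pos.2 ⟨i, hi⟩)]
        simp only [smul_smul, ← sub_smul]
        congr 1
        ring
      · simp
    · have hx : TH F (mon F n α u) (X F n (Sum.inr i)) = pd F n (Sum.inl i) (mon F n α u) := by
        have := TH_skew F (b := X F n (Sum.inr i)) (c := mon F n α u) (mon_mem F rfl) hm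
        rw [this]
        exact neg_eq_iff_eq_neg.2 (TH_X_inr F i _)
      simp only [thc, Sum.swap_inr, mu_inl, pow_zero, Module.End.one_apply, map_sub, map_smul,
        Sum.elim_inr, hx]
      rw [pd_inl_mon]
      split_ifs
      · simp
      · rw [Gam_mon]

variable [Fact p.Prime] [CharP F p]

theorem vf_OTdeg {l m : ℤ} {f : Y n → OO F n} (hf : ∀ r, f r ∈ OTdeg F p t l) {a : OO F n}
    (ha : a ∈ OTdeg F p t m) : vf F f a ∈ OTdeg F p t (l + m - 1) := by
  rw [vf_apply]
  refine Submodule.sum_mem _ fun r _ => ?_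
  have := mul_OTdeg F p t (hf r) (pd_OTdeg F p t r ha)
  rwa [show l + (m - 1) = l + m - 1 by ring] at this

theorem TH_mem_WW {a : OO F n} (ha : a ∈ OddPart F p t) : TH F a ∈ WW F p t :=
  ⟨thc F a, fun s _ => ⟨pd_OT F p t _ (sig_OT F p t _ ha.1), by simpa using thc_odd F ha.2 s⟩,
    (TH_eq_vf F a).symm⟩

variable (F p t) in
/-- The map `T_H` from the odd part of `𝒪(n, n; t)` to `ℋ𝒪`. -/
noncomputable def oddTH : OddPart F p t →ₗ[F] HO F p t where
  toFun a := ⟨⟨TH F (a : OO F n), TH_mem_WW a.2⟩, (a : OO F n), a.2.1, rfl⟩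
  map_add' a b := Subtype.ext (Subtype.ext (map_add (TH F) (a : OO F n) (b : OO F n)))
  map_smul' c a := Subtype.ext (Subtype.ext (map_smul (TH F) c (a : OO F n)))

theorem oddTH_bijective : Function.Bijective (oddTH F p t) := by
  constructor
  · intro a b hab
    have h : TH F (a : OO F n) = TH F (b : OO F n) :=
      congrArg (fun x : HO F p t => ((x : WW F p t) : Module.End F (OO F n))) hab
    refine Subtype.ext (sub_eq_zero.1
      (OddPart.eq_zero_of_TH_eq_zero (Submodule.sub_mem _ a.2 b.2) ?_))
    rw [map_sub, h, sub_self]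
  · rintro ⟨⟨x, hx⟩, h⟩
    obtain ⟨a, ha, hax⟩ := h
    obtain rfl : TH F a = x := hax
    obtain ⟨b, hb, h⟩ := exists_odd F p t ha hx
    exact ⟨⟨b, hb⟩, Subtype.ext (Subtype.ext h)⟩

variable (F p t) in
/-- The identification of `ℋ𝒪` with the odd part of `𝒪(n, n; t)`. -/
noncomputable def toHO : OddPart F p t ≃ₗ[F] HO F p t :=
  LinearEquiv.ofBijective (oddTH F p t) oddTH_bijective

theorem lie_toHO (a b : OddPart F p t) :
    ⁅toHO F p t a, toHO F p t b⁆ =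
      toHO F p t ⟨TH F (a : OO F n) b, TH_OddPart F p t a.2 b.2⟩ :=
  Subtype.ext (Subtype.ext (lie_TH F a.2.2 b.2.2))

/-- Coefficients of T_H(a) are first derivatives of a, and degree k in `WW` means coefficients of
degree k + 1. Conversely, the degree of each term of a is recovered from T_H(a)(x_{i'}) or, for
exterior terms, from T_H(a)(x_i x_{i'}). -/
theorem toHO_mem_HOdeg (ht : ∀ i, 0 < t i) {k : ℤ} (a : OddPart F p t) :
    toHO F p t a ∈ HOdeg F p t k ↔ (a : OO F n) ∈ OTdeg F p t (k + 2) := by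
  constructor
  · rintro ⟨f, hf, hfa⟩
    have hTH : vf F f = TH F (a : OO F n) := hfa
    have hdeg : ∀ {m b}, b ∈ OTdeg F p t m → TH F (a : OO F n) b ∈ OTdeg F p t (k + m) := by
      intro m b hb
      have := vf_OTdeg (fun r => hf r trivial) hb
      rwa [hTH, show k + 1 + m - 1 = k + m by ring] at this
    rw [mem_OTdeg]
    intro α u hne
    obtain ⟨h1, h2⟩ := (mem_OddPart F p t).1 a.2 _ _ hne
    refine ⟨h1, ?_⟩
    by_cases hα : α = 0
    · obtain ⟨i, hi⟩ : u.Nonempty := by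
        rw [Finset.nonempty_iff_ne_empty]
        rintro rfl
        simp at h2
      have := hdeg (linear_mem_OTdeg ht i i)
      rw [TH_skew F (linear_mem_OddPart (p := p) ht i i).2 a.2.2, mem_OTdeg] at this
      refine (this α u ?_).2
      simpa [TH_torus_apply, hi, hα] using hα ▸ hne
    · obtain ⟨i, hi⟩ : ∃ i, α i ≠ 0 := by
        by_contra! h
        exact hα (funext h)
      have e : α - Pi.single i 1 + Pi.single i 1 = α := by
        ext l
        by_cases hl : l = i
        · subst hl; simp; omega
        · simp [Pi.single_eq_of_ne hl]
      have := hdeg (odd_variable_mem_OTdeg i)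
      rw [TH_odd_variable_right i a.2, mem_OTdeg] at this
      have := (this (α - Pi.single i 1) u (by rwa [pd_inl_apply, e])).2
      rw [← e]
      simp only [Pi.add_apply, Finset.sum_add_distrib, Finset.sum_pi_single', Finset.mem_univ,
        if_true]
      push_cast at this ⊢
      omega
  · intro h
    refine ⟨thc F (a : OO F n), fun s _ => ?_, (TH_eq_vf F _).symm⟩
    have := thc_OTdeg h s
    rwa [show k + 2 - 1 = k + 1 by ring] at this

/-- The coefficients of an operator are unique by `vf_injective`, so any presentation of an element
of `WW` inherits truncation and parity. -/
theorem odd_coeff {E : WW F p t} {f : Y n → OO F n} (hf : (E : Module.End F (OO F n)) = vf F f)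
    (r : Y n) : f r ∈ OT F p t ∧ f r ∈ par F n (mu r) := by
  obtain ⟨g, hg, h⟩ := E.2
  rw [hf] at h
  rw [← vf_injective F h]
  exact ⟨(hg r trivial).1, by simpa using (hg r trivial).2⟩

theorem lie_mem_Wdeg {k l : ℤ} {D E : WW F p t} (hD : D ∈ Wdeg F p t k) (hE : E ∈ Wdeg F p t l) :
    ⁅D, E⁆ ∈ Wdeg F p t (k + l) := by
  obtain ⟨f, hf, hfD⟩ := hD
  obtain ⟨g, hg, hgE⟩ := hE
  replace hfD : vf F f = (D : Module.End F (OO F n)) := hfD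
  replace hgE : vf F g = (E : Module.End F (OO F n)) := hgE
  refine ⟨_, fun s _ => ?_, (lie_vf F (fun r => (odd_coeff hfD.symm r).2)
    fun r => (odd_coeff hgE.symm r).2).symm.trans ?_⟩
  · have h1 := vf_OTdeg (fun r => hf r trivial) (hg s trivial)
    have h2 := vf_OTdeg (fun r => hg r trivial) (hf s trivial)
    rw [show k + 1 + (l + 1) - 1 = k + l + 1 by ring] at h1
    rw [show l + 1 + (k + 1) - 1 = k + l + 1 by ring] at h2
    exact Submodule.sub_mem _ h1 h2
  · rw [hfD, hgE]
    rfl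

theorem Gam_mem_Wdeg : Gam F p t ∈ Wdeg F p t 0 := by
  refine ⟨_, ?_, rfl⟩
  rintro (i | i) -
  · exact Submodule.zero_mem _
  · exact odd_variable_mem_OTdeg i

theorem lie_Gam_toHO (a : OddPart F p t) :
    ((⁅Gam F p t, (toHO F p t a : WW F p t)⁆ : WW F p t) : Module.End F (OO F n)) =
      TH F (vf F (Sum.elim 0 fun i => X F n (Sum.inr i)) (a : OO F n) - (a : OO F n)) :=
  lie_Gam_TH a.2.2

/-- `Γ` normalizes `ℋ𝒪`. -/
theorem HOGam_le_normalizer : HOGam F p t ≤ (HO F p t).normalizer.toSubmodule := by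
  refine sup_le (HO F p t).le_normalizer ?_
  rw [Submodule.span_singleton_le_iff_mem]
  refine (LieSubalgebra.mem_normalizer_iff _ _).2 fun x hx => ?_
  obtain ⟨a, ha⟩ := (toHO F p t).surjective ⟨x, hx⟩
  have hx' : x = (toHO F p t a : WW F p t) := congrArg Subtype.val ha.symm
  rw [hx']
  refine ⟨vf F (Sum.elim 0 fun i => X F n (Sum.inr i)) (a : OO F n) - (a : OO F n), ?_,
    (lie_Gam_toHO a).symm⟩
  exact Submodule.sub_mem _ (vf_OT F p t (fun r => (odd_coeff (E := Gam F p t) rfl r).1) a.2.1) a.2.1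

/-- The derivation `ad E` of `ℋ𝒪` defined by an element `E` of its normalizer. -/
noncomputable def normalizerAd (E : WW F p t) (hE : E ∈ (HO F p t).normalizer) :
    LieDerivation F (HO F p t) (HO F p t) where
  toFun x := ⟨⁅E, (x : WW F p t)⁆, (LieSubalgebra.mem_normalizer_iff _ _).1 hE x x.2⟩
  map_add' x y := Subtype.ext (lie_add E (x : WW F p t) y)
  map_smul' c x := Subtype.ext (lie_smul c E (x : WW F p t))
  leibniz' x y := Subtype.ext <| by
    change ⁅E, ⁅(x : WW F p t), (y : WW F p t)⁆⁆ =
      ⁅(x : WW F p t), ⁅E, (y : WW F p t)⁆⁆ - ⁅(y : WW F p t), ⁅E, (x : WW F p t)⁆⁆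
    rw [leibniz_lie E, ← lie_skew (y : WW F p t)]
    abel

theorem coe_normalizerAd (E : WW F p t) (hE : E ∈ (HO F p t).normalizer) (x : HO F p t) :
    (normalizerAd E hE x : WW F p t) = ⁅E, (x : WW F p t)⁆ := rfl

theorem normalizerAd_mem_DerDeg {k : ℤ} {E : WW F p t} (hE : E ∈ (HO F p t).normalizer)
    (hk : E ∈ Wdeg F p t k) : normalizerAd E hE ∈ DerDeg F p t k :=
  fun _ _ hx => lie_mem_Wdeg hk hx

/-- A derivation of nonnegative degree of `ℋ𝒪` is `ad E` for some `E ∈ ℋ𝒪 + F Γ`. -/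
theorem exists_eq_lie {k : ℤ} (hk : 0 ≤ k) (hp : 2 < p) (hn : 3 ≤ n) (ht : ∀ i, 0 < t i)
    {φ : LieDerivation F (HO F p t) (HO F p t)} (hφ : φ ∈ DerDeg F p t k) :
    ∃ y ∈ HOdeg F p t k, ∃ κ : F, (k ≠ 0 → κ = 0) ∧
      ∀ x : HO F p t, (φ x : WW F p t) = ⁅(y : WW F p t) + κ • Gam F p t, (x : WW F p t)⁆ := by
  set e := toHO F p t
  -- The extension from the odd part to the whole algebra is arbitrary; only its values on the odd
  -- part are used.
  obtain ⟨D, hD⟩ := LinearMap.exists_extend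
    ((OddPart F p t).subtype ∘ₗ e.symm.toLinearMap ∘ₗ φ.toLinearMap ∘ₗ e.toLinearMap)
  have hDa : ∀ a : OddPart F p t, D a = e.symm (φ (e a)) := fun a => LinearMap.congr_fun hD a
  have hmem : ∀ {a}, a ∈ OddPart F p t → D a ∈ OddPart F p t := fun {a} ha => by
    rw [hDa ⟨a, ha⟩]
    exact Subtype.prop _
  have hφe : ∀ a : OddPart F p t, φ (e a) = e ⟨D a, hmem a.2⟩ := fun a => by
    rw [← e.symm_apply_eq]
    exact Subtype.ext (hDa a).symm
  have hder : IsBracketDerivation F p t k D := by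
    refine ⟨hmem, fun {a b} ha hb => ?_, fun {m a} ha ham => ?_⟩
    · have h := φ.apply_lie_eq_sub (e ⟨a, ha⟩) (e ⟨b, hb⟩)
      rw [hφe, hφe, lie_toHO, lie_toHO, lie_toHO, hφe] at h
      have h := congrArg Subtype.val (e.injective (h.trans (map_sub e _ _).symm))
      refine h.trans ?_
      simp only [AddSubgroupClass.coe_sub]
      rw [TH_skew F hb.2 (hmem ha).2]
      abel
    · have h1 := (toHO_mem_HOdeg ht (k := m - 2) ⟨a, ha⟩).2 (by simpa using ham)
      have h2 := hφ _ _ h1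
      rw [hφe, toHO_mem_HOdeg ht] at h2
      rwa [show k + (m - 2) + 2 = m + k by ring] at h2
  obtain ⟨b, hb, hbk, κ, hκ, h⟩ := hder.exists_eq hk hp hn ht
  refine ⟨e ⟨b, hb⟩, (toHO_mem_HOdeg ht _).2 hbk, κ, hκ, fun x => ?_⟩
  obtain ⟨a, rfl⟩ := e.surjective x
  rw [hφe, add_lie, smul_lie]
  refine Subtype.ext ?_
  change TH F (D a) = (TH F b * TH F (a : OO F n) - TH F (a : OO F n) * TH F b) +
    κ • ((⁅Gam F p t, (toHO F p t a : WW F p t)⁆ : WW F p t) : Module.End F (OO F n))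
  rw [lie_Gam_toHO, h a a.2, map_add, map_smul, lie_TH F hb.2 a.2.2]

/-- The centralizer of `ℋ𝒪` in `𝒲` is zero. -/
theorem eq_zero_of_lie_HO_eq_zero (hp : 2 < p) (hn : 3 ≤ n) (ht : ∀ i, 0 < t i) {E : WW F p t}
    (hE : ∀ x : HO F p t, ⁅E, (x : WW F p t)⁆ = 0) : E = 0 := by
  obtain ⟨f, -, hfE⟩ := E.2
  have hf : ∀ r, f r ∈ par F n (mu r) := fun r => (odd_coeff hfE.symm r).2
  have h20 : (2 : F) ≠ 0 := by
    have : ((2 : ℕ) : F) ≠ 0 := by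
      rw [Ne, CharP.cast_eq_zero_iff F p]
      exact fun h => by have := Nat.le_of_dvd (by norm_num) h; omega
    simpa using this
  -- The coefficient at ∂_s of the equation [E, T_H(a)] = 0.
  have key : ∀ a ∈ OddPart F p t, ∀ s, vf F f (thc F a s) = TH F a (f s) := by
    intro a ha s
    have h : vf F f * TH F a - TH F a * vf F f = 0 := by
      have := congrArg Subtype.val (hE (toHO F p t ⟨a, ha⟩))
      rw [hfE]
      exact this
    rw [TH_eq_vf, lie_vf F hf (thc_odd F ha.2), ← map_zero (vf F)] at h
    have := congrFun (vf_injective F h) s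
    rw [TH_eq_vf]
    exact sub_eq_zero.1 this
  have hconst : vf F f (mon F n 0 ∅) = 0 := by
    rw [vf_apply]
    refine Finset.sum_eq_zero ?_
    rintro (i | i) -
    · simp [pd_inl_mon]
    · simp [pd_inr_mon']
  have hX : ∀ i, vf F f (mon F n 0 {i}) = f (Sum.inr i) := fun i => vf_X F f (Sum.inr i)
  have hX' : ∀ i, vf F f (mon F n (Pi.single i 1) ∅) = f (Sum.inl i) := fun i =>
    vf_X F f (Sum.inl i)
  -- For a = x_{i'} the coefficients of T_H(a) are constants, which E kills. So all coefficients of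
  -- E are exterior.
  have hpd : ∀ s i, pd F n (Sum.inl i) (f s) = 0 := by
    intro s i
    have h := key _ (odd_variable_mem_OddPart i) s
    rw [TH_X_inr] at h
    rw [← neg_eq_zero, ← h]
    rcases s with j | j
    · by_cases hij : j = i
      · subst hij
        simp [thc, sig_mon, pd_inr_mon', hconst]
      · simp [thc, sig_mon, pd_inr_mon', hij]
    · simp [thc, pd_inl_mon]
  have hsupp : ∀ s α u, α ≠ 0 → f s (α, u) = 0 := by
    intro s α u hα
    obtain ⟨i, hi⟩ : ∃ i, α i ≠ 0 := by
      by_contra! h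
      exact hα (funext h)
    have h := congrArg (fun a => a (α - Pi.single i 1, u)) (hpd s i)
    have e : α - Pi.single i 1 + Pi.single i 1 = α := by
      ext l
      by_cases hl : l = i
      · subst hl; simp; omega
      · simp [Pi.single_eq_of_ne hl]
    simp only [pd_inl_apply, e] at h
    exact h
  -- For a = x_i x_{i'} the coefficient of ∂_i in T_H(a) is -x_i, so -f_i = [i ∈ u] f_i at each
  -- exterior term x^u; both cases give 0, as 2 ≠ 0.
  have hinl : ∀ i, f (Sum.inl i) = 0 := by
    intro i
    ext ⟨α, u⟩
    by_cases hα : α = 0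
    · subst hα
      have h := congrArg (fun a => a (0, u)) (key _ (linear_mem_OddPart ht i i) (Sum.inl i))
      simp only [TH_torus_apply, thc, Sum.swap_inl, mu_inr, pow_one, sig_mon, map_smul,
        pd_inr_mon', Finset.mem_singleton, if_true, Finset.erase_singleton, hX',
        Finset.card_singleton, Finsupp.smul_apply, Pi.zero_apply, Nat.cast_zero, sub_zero,
        smul_eq_mul] at h
      have e : eps F {i} ∅ = 1 := by simp [eps, inv]
      rw [e, one_mul] at h
      change f (Sum.inl i) (0, u) = 0
      split_ifs at h
      · have : (2 : F) * f (Sum.inl i) (0, u) = 0 := by linear_combination -h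
        exact (mul_eq_zero.1 this).resolve_left h20
      · linear_combination -h
    · exact hsupp _ _ _ hα
  set c : Fin n → F := fun j => f (Sum.inr j) (0, {j}) with hc
  -- The torus elements force f_{j'} to have the weight of x_{j'}, so E is diagonal.
  have hinr : ∀ j, f (Sum.inr j) = c j • mon F n 0 {j} := by
    intro j
    ext ⟨α, u⟩
    rw [Finsupp.smul_apply, mon_apply]
    by_cases hα : α = 0
    · subst hα
      by_cases hu : {j} = u
      · simp [hc, hu]
      · rw [if_neg (fun h => hu h.2), smul_zero]
        by_contra hne
        refine hu ?_
        ext i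
        have h := congrArg (fun a => a (0, u)) (key _ (linear_mem_OddPart ht i i) (Sum.inr j))
        simp only [TH_torus_apply, thc, Sum.swap_inr, mu_inl, pow_zero, Module.End.one_apply,
          pd_inl_mon, Pi.zero_apply, Nat.cast_zero, sub_zero] at h
        by_cases hij : i = j
        · subst hij
          simp only [Pi.single_eq_same, one_ne_zero, if_false, tsub_self, hX] at h
          by_contra hiu
          have : i ∉ u := by simpa using hiu
          rw [if_neg this, zero_mul] at h
          exact hne h
        · rw [if_pos (Pi.single_eq_of_ne (Ne.symm hij) 1), map_zero] at h
          by_contra hiu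
          have : i ∈ u := by simpa [hij] using hiu
          rw [if_pos this, one_mul] at h
          exact hne h.symm
    · rw [if_neg (fun h => hα h.1.symm), smul_zero]
      exact hsupp _ _ _ hα
  have hthird : ∀ j k : Fin n, ∃ l, l ≠ j ∧ l ≠ k := by
    intro j k
    have : ({j, k} : Finset (Fin n)).card < (Finset.univ : Finset (Fin n)).card := by
      have := Finset.card_le_two (a := j) (b := k)
      simp
      omega
    obtain ⟨l, -, hl⟩ := Finset.exists_mem_notMem_of_card_lt_card this
    exact ⟨l, by grind⟩
  have hvf : ∀ u, vf F f (mon F n 0 u) = (∑ i ∈ u, c i) • mon F n 0 u := by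
    intro u
    rw [vf_apply, Fintype.sum_sum_type, Finset.sum_eq_zero, zero_add]
    · simp only [hinr, map_smul, LinearMap.smul_apply, mul_X_pd_inr, smul_smul, ← Finset.sum_smul]
      congr 1
      simp
    · simp [hinl]
  -- For a cubic exterior a = ± x_{l'} x_{j'} x_{k'}, the coefficient of ∂_l in T_H(a) is ± x_{j'}
  -- x_{k'}, an eigenvector of E for c_j + c_k. It is killed because f_l = 0. Three distinct indices
  -- are needed.
  have hadd : ∀ j k, j ≠ k → c j + c k = 0 := by
    intro j k hjk
    obtain ⟨l, hlj, hlk⟩ := hthird j k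
    have hcard : ({l, j, k} : Finset (Fin n)).card = 3 := Finset.card_eq_three.2
      ⟨l, j, k, hlj, hlk, hjk, rfl⟩
    have h := key _ (exterior_mem_OddPart (by rw [hcard])) (Sum.inl l)
    have he : ({l, j, k} : Finset (Fin n)).erase l = {j, k} := by grind
    rw [hinl, map_zero, thc, Sum.swap_inl, mu_inr, pow_one, sig_mon, map_smul, pd_inr_mon',
      if_pos (by simp), he, map_smul, map_smul, hvf, Finset.sum_pair hjk] at h
    have := congrArg (fun a => a (0, {j, k})) h
    have h0 : eps F {l} {j, k} ≠ 0 := eps_ne_zero F (by simp [hlj, hlk])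
    simpa [mon_apply, h0] using this
  have hc0 : ∀ j, c j = 0 := by
    intro j
    obtain ⟨k, hkj, -⟩ := hthird j j
    obtain ⟨l, hlj, hlk⟩ := hthird j k
    have : 2 * c j = 0 := by
      linear_combination hadd j k hkj.symm + hadd j l hlj.symm - hadd k l hlk.symm
    exact (mul_eq_zero.1 this).resolve_left h20
  refine Subtype.ext ?_
  rw [← hfE]
  have : f = 0 := by
    funext r
    rcases r with i | i
    · exact hinl i
    · rw [hinr, hc0, zero_smul]
      rfl
  rw [this, map_zero]
  rfl

end

end OddHamiltonian

/-! ### The three assertions -/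

theorem mainTheorem7 (F : Type*) [Field F] (p : ℕ) [Fact p.Prime] [CharP F p] (hp : 3 < p)
    (n : ℕ) (hn : 3 ≤ n) (t : Fin n → ℕ) (ht : ∀ i, 0 < t i) :
    (∀ k : ℤ, 0 < k →
      OddHamiltonian.DerDeg F p t k =
        (OddHamiltonian.HOdeg F p t k).map
          (LieDerivation.ad F (OddHamiltonian.HO F p t)).toLinearMap) ∧
    (OddHamiltonian.DerDeg F p t 0).map (OddHamiltonian.derIncl F p t) =
      (OddHamiltonian.HOGam F p t ⊓ OddHamiltonian.Wdeg F p t 0).map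
        (OddHamiltonian.adHO F p t) ∧
    (∀ k : ℤ, 0 ≤ k →
      (OddHamiltonian.HO F p t).normalizer.toSubmodule ⊓ OddHamiltonian.Wdeg F p t k =
        OddHamiltonian.HOGam F p t ⊓ OddHamiltonian.Wdeg F p t k) := by
  open OddHamiltonian in
  have hp2 : 2 < p := by omega
  have hmem : ∀ (y : HO F p t) (κ : F), (y : WW F p t) + κ • Gam F p t ∈ HOGam F p t :=
    fun y κ => Submodule.add_mem_sup y.2
      (Submodule.smul_mem _ _ (Submodule.mem_span_singleton_self _))
  refine ⟨fun k hk => le_antisymm (fun φ hφ => ?_) ?_, le_antisymm ?_ ?_, fun k hk =>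
    le_antisymm (fun E hE => ⟨?_, hE.2⟩) (inf_le_inf_right _ HOGam_le_normalizer)⟩
  · obtain ⟨y, hy, κ, hκ, h⟩ := exists_eq_lie hk.le hp2 hn ht hφ
    refine ⟨y, hy, LieDerivation.ext fun x => Subtype.ext ?_⟩
    change ((LieDerivation.ad F (HO F p t) y x : HO F p t) : WW F p t) = _
    rw [LieDerivation.ad_apply_apply, h x, hκ hk.ne', zero_smul, add_zero]
    rfl
  · rintro _ ⟨y, hy, rfl⟩ i x hx
    change LieDerivation.ad F (HO F p t) y x ∈ _
    rw [LieDerivation.ad_apply_apply]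
    exact lie_mem_Wdeg hy hx
  · rintro _ ⟨φ, hφ, rfl⟩
    obtain ⟨y, hy, κ, -, h⟩ := exists_eq_lie le_rfl hp2 hn ht hφ
    exact ⟨(y : WW F p t) + κ • Gam F p t,
      ⟨hmem y κ, Submodule.add_mem _ hy (Submodule.smul_mem _ _ Gam_mem_Wdeg)⟩,
      LinearMap.ext fun x => (h x).symm⟩
  · rintro _ ⟨E, hE, rfl⟩
    exact ⟨normalizerAd E (HOGam_le_normalizer hE.1), normalizerAd_mem_DerDeg _ hE.2, rfl⟩
  · obtain ⟨y, -, κ, -, h⟩ := exists_eq_lie hk hp2 hn ht (normalizerAd_mem_DerDeg hE.1 hE.2)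
    -- Both elements induce the same derivation of `HO`, so their difference lies in the trivial
    -- centralizer.
    have h0 : E - ((y : WW F p t) + κ • Gam F p t) = 0 :=
      eq_zero_of_lie_HO_eq_zero hp2 hn ht fun x => by
        rw [sub_lie, ← h x, coe_normalizerAd, sub_self]
    rw [sub_eq_zero.1 h0]
    exact hmem y κ
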